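/- Let $k\ge 1$ be an integer. Let $d_k(n)$ be the number of ordered $k$-tuples of positive integers with product $n$, and let $$a_k=\prod_{p}\left(\Big(1-\frac1p\Big)^{k^2}\sum_{j=0}^{\infty}\frac{d_k(p^j)^2}{p^j}\right),$$ where $p$ runs over the primes. For real $l_1,\dots,l_k$ let $G_k(l_1,\dots,l_k)$ be the number of $k\times k$ matrices $(x_{ij})$ with nonnegative integer entries such that $\sum_{i=1}^k x_{ij}\le l_j$ for every $j$ and $\sum_{j=1}^k x_{ij}\le l_i$ for every $i$. Theorem. The series and the product defining $a_k$ converge, and $a_k>0$. For all real $X_1,\dots,X_k$ the limit $$L(X_1,\dots,X_k)=\lim_{T\to\infty}\frac1T\int_0^T\prod_{i=1}^k\Big|\sum_{1\le n\le X_i}\frac{1}{n^{1/2+it}}\Big|^2\,dt$$ exists. Let $X_i=X_i(Y)=Y^{m_i}$ for $i=1,\dots,k$, where the real exponents $m_i=m_i(Y)$ may depend on $Y$, satisfy $m_i=O(1)$ as $Y\to\infty$, and are such that $X_i\to\infty$ as $Y\to\infty$ for every $i$ (for instance, the $m_i$ are positive constants). Then, as $Y\to\infty$, $$L(X_1,\dots,X_k)\sim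 a_k\,G_k(\log X_1,\dots,\log X_k),$$ and moreover $$L(X_1,\dots,X_k)=a_k\,G_k(\log X_1,\dots,\log X_k)+O\big((\log Y)^{k^2-1}\big).$$ In particular, when all lengths are equal to $X$, as $X\to\infty$, $$\lim_{T\to\infty}\frac1T\int_0^T\Big|\sum_{1\le n\le X}\frac{1}{n^{1/2+it}}\Big|^{2k}\,dt=a_k\,G_k(\log X,\dots,\log X)+O\big((\log X)^{k^2-1}\big).$$ -/

import Mathlib

open Filter Topology Asymptotics

noncomputable section

/-- The partial sum `∑_{n ≤ X} n^{-1/2-it}` of the zeta function on the critical line. -/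
def zetaPartialSum (X t : ℝ) : ℂ :=
  ∑ n ∈ Finset.Icc 1 ⌊X⌋₊, 1 / (n : ℂ) ^ ((1 / 2 : ℂ) + (t : ℂ) * Complex.I)

/-- The `k`-fold divisor function: the number of ordered `k`-tuples of positive integers with
product `n` (for `n ≥ 1`). -/
def divisorFun (k n : ℕ) : ℕ := (Nat.finMulAntidiag k n).card

/-- The factor at `p` of the Euler product that defines the arithmetic factor. -/
def arithLocalFactor (k : ℕ) (p : Nat.Primes) : ℝ :=
  (1 - 1 / ((p : ℕ) : ℝ)) ^ (k ^ 2) *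
    ∑' j : ℕ, (divisorFun k ((p : ℕ) ^ j) : ℝ) ^ 2 / ((p : ℕ) : ℝ) ^ j

/-- The arithmetic factor `a_k`. -/
def arithFactor (k : ℕ) : ℝ := ∏' p : Nat.Primes, arithLocalFactor k p

/-- The `k × k` matrices with entries in `ℕ`, with `i`-th row sum at most `l i` and
`j`-th column sum at most `l j`. -/
def pseudomagicSquares {k : ℕ} (l : Fin k → ℝ) : Set (Matrix (Fin k) (Fin k) ℕ) :=
  {x | (∀ j, ∑ i, (x i j : ℝ) ≤ l j) ∧ ∀ i, ∑ j, (x i j : ℝ) ≤ l i}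

theorem pseudomagicSquares_finite {k : ℕ} (l : Fin k → ℝ) : (pseudomagicSquares l).Finite := by
  have h : (Set.pi Set.univ fun i : Fin k =>
      Set.pi Set.univ fun _ : Fin k => Set.Iic ⌊l i⌋₊).Finite :=
    Set.Finite.pi fun i => Set.Finite.pi fun _ => Set.finite_Iic _
  refine h.subset fun x hx i _ j _ => ?_
  exact Nat.le_floor ((Finset.single_le_sum (f := fun j => (x i j : ℝ))
    (fun _ _ => Nat.cast_nonneg _) (Finset.mem_univ j)).trans (hx.2 i))

/-- `G_k(l_1, …, l_k)`, the cardinality of the (finite) set `pseudomagicSquares l`. -/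
def pseudomagicCount {k : ℕ} (l : Fin k → ℝ) : ℕ := (pseudomagicSquares l).ncard

end

/-!
The mean value of a product of Dirichlet polynomials only sees the diagonal
(`tendsto_average_zetaPartialSum`): `L(X)` is the sum of `1 / (n₁ ⋯ n_k)` over the pairs of tuples
`n`, `m` with `n_i, m_i ≤ X_i` and `n₁ ⋯ n_k = m₁ ⋯ m_k`.

The solutions of this equation are parametrized by a multiplicative northwest corner rule: each pair
`(n, m)` consists of the row products and the column products of exactly one matrix `x` of positive
integers in which any entry is coprime to every entry strictly below and strictly to the left of it
(`IsStaircase.ext`, `exists_isStaircase`). The reason is that the product of the entries of an upper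
left corner of such a matrix has to be the gcd of the corresponding partial products of `n` and `m`.
So `L(X)` is the sum of `∏ 1 / x_ij` over these staircase matrices, with row and column products
bounded by the `X_i` (`diagonalSum_eq_staircaseSum`). Applied to a prime power, the same bijection
shows that the factor of `a_k` at `p` is the density of the staircase condition at `p`
(`arithLocalFactor_eq_localDensity`), which is `1 + O(p⁻²)`.

Inclusion-exclusion over the crossing pairs of cells at each prime writes the staircase condition as
a signed combination of conditions `r_ij ∣ x_ij`. Under such conditions, the sum of `∏ r_ij / x_ij`
is compared with the number `G` of lattice points of the polytope by replacing, one coordinate at a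
time, the measure with mass `r / x` at `log x` for `r ∣ x` by the counting measure on the
nonnegative integers (`abs_productMass_sub_le`); on an interval `[0, B]` these differ by at most
`1 + log r` (`abs_sum_multiples_sub_le`). The resulting errors are summable over all moduli because
`∑ p ^ (-3/2)` converges, which gives the uniform estimate of `exists_abs_diagonalSum_sub_le`:

  `|L(X) - a_k G(log X)| ≤ C ∑_e ∏_{f ≠ e} (1 + min (l_{f.1}, l_{f.2}))`, with `l_i = log X_i`.

Since `G` is at least a constant times the full product `∏_f (1 + min (l_{f.1}, l_{f.2}))`, the
error is `o(G)` as soon as all `l_i` tend to infinity, however unbalanced they are; and it is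
`O((log Y) ^ (k ^ 2 - 1))` because it involves products of `k ^ 2 - 1` factors.
-/

/-! ### The multiplicative northwest corner rule -/

/-- A matrix (indexed by `Fin k × Fin k`) of natural numbers is *staircase* if any two entries, one
strictly above and strictly to the right of the other, are coprime. At each prime, such a matrix is
supported on a monotone chain of positions, as in the northwest corner rule. -/
def IsStaircase {k : ℕ} (x : Fin k × Fin k → ℕ) : Prop :=
  ∀ e f : Fin k × Fin k, e.1 < f.1 → f.2 < e.2 → Nat.Coprime (x e) (x f)

/-- The product of the entries of the `i`-th row. -/
def rowProd {k : ℕ} (x : Fin k × Fin k → ℕ) (i : Fin k) : ℕ := ∏ j, x (i, j)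

/-- The product of the entries of the `j`-th column. -/
def colProd {k : ℕ} (x : Fin k × Fin k → ℕ) (j : Fin k) : ℕ := ∏ i, x (i, j)

/-- The product of the first `i` values of `n`. -/
def initProd {k : ℕ} (n : Fin k → ℕ) (i : ℕ) : ℕ := ∏ a : Fin k, if (a : ℕ) < i then n a else 1

/-- The product of the entries in the upper left `i × j` corner. -/
def cornerProd {k : ℕ} (x : Fin k × Fin k → ℕ) (i j : ℕ) : ℕ :=
  ∏ e : Fin k × Fin k, if (e.1 : ℕ) < i ∧ (e.2 : ℕ) < j then x e else 1

/-- The product of the entries in the upper right corner, above row `i` and from column `j` on. -/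
def upperRightProd {k : ℕ} (x : Fin k × Fin k → ℕ) (i j : ℕ) : ℕ :=
  ∏ e : Fin k × Fin k, if (e.1 : ℕ) < i ∧ ¬ (e.2 : ℕ) < j then x e else 1

/-- The product of the entries in the lower left corner, from row `i` on and left of column `j`. -/
def lowerLeftProd {k : ℕ} (x : Fin k × Fin k → ℕ) (i j : ℕ) : ℕ :=
  ∏ e : Fin k × Fin k, if ¬ (e.1 : ℕ) < i ∧ (e.2 : ℕ) < j then x e else 1

section

variable {k : ℕ}

theorem initProd_rowProd (x : Fin k × Fin k → ℕ) (i j : ℕ) :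
    initProd (rowProd x) i = cornerProd x i j * upperRightProd x i j := by
  unfold initProd rowProd cornerProd upperRightProd
  rw [← Finset.prod_mul_distrib, Fintype.prod_prod_type]
  refine Finset.prod_congr rfl fun a _ => ?_
  split_ifs with h
  · refine Finset.prod_congr rfl fun b _ => ?_
    by_cases hb : (b : ℕ) < j <;> simp [h, hb]
  · simp [h]

theorem initProd_colProd (x : Fin k × Fin k → ℕ) (i j : ℕ) :
    initProd (colProd x) j = cornerProd x i j * lowerLeftProd x i j := by
  unfold initProd colProd cornerProd lowerLeftProd
  rw [← Finset.prod_mul_distrib, Fintype.prod_prod_type_right]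
  refine Finset.prod_congr rfl fun b _ => ?_
  split_ifs with h
  · refine Finset.prod_congr rfl fun a _ => ?_
    by_cases ha : (a : ℕ) < i <;> simp [h, ha]
  · simp [h]

theorem cornerProd_zero_left (x : Fin k × Fin k → ℕ) (j : ℕ) : cornerProd x 0 j = 1 := by
  simp [cornerProd]

theorem cornerProd_zero_right (x : Fin k × Fin k → ℕ) (i : ℕ) : cornerProd x i 0 = 1 := by
  simp [cornerProd]

theorem initProd_zero (n : Fin k → ℕ) : initProd n 0 = 1 := by
  simp [initProd]

theorem initProd_full (n : Fin k → ℕ) : initProd n k = ∏ i, n i := by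
  simp [initProd]

theorem initProd_succ (n : Fin k → ℕ) (i : Fin k) :
    initProd n (i + 1) = initProd n i * n i := by
  have h : n i = ∏ a, if a = i then n a else 1 := by simp
  unfold initProd
  conv_rhs => rw [h]
  rw [← Finset.prod_mul_distrib]
  refine Finset.prod_congr rfl fun a _ => ?_
  rcases lt_trichotomy a i with h | h | h
  · have h1 : (a : ℕ) < i := h
    simp [h1, h.ne, Nat.lt_succ_of_lt h1]
  · subst h; simp
  · have h1 : (i : ℕ) < a := h
    simp [h.ne', show ¬ ((a : ℕ) < i + 1) by omega, show ¬ ((a : ℕ) < i) by omega]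

theorem initProd_pos {n : Fin k → ℕ} (hn : ∀ i, 0 < n i) (i : ℕ) : 0 < initProd n i := by
  refine Finset.prod_pos fun a _ => ?_
  split_ifs
  exacts [hn a, one_pos]

theorem cornerProd_pos {x : Fin k × Fin k → ℕ} (hx : ∀ e, 0 < x e) (i j : ℕ) :
    0 < cornerProd x i j := by
  refine Finset.prod_pos fun a _ => ?_
  split_ifs
  exacts [hx a, one_pos]

/-- An entry is the mixed multiplicative difference of the corner products. -/
theorem cornerProd_succ_succ (x : Fin k × Fin k → ℕ) (i j : Fin k) :
    cornerProd x (i + 1) (j + 1) * cornerProd x i j =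
      x (i, j) * (cornerProd x i (j + 1) * cornerProd x (i + 1) j) := by
  have h : x (i, j) = ∏ e, if e = (i, j) then x e else 1 := by simp
  unfold cornerProd
  rw [h]
  simp_rw [← Finset.prod_mul_distrib]
  refine Finset.prod_congr rfl fun e _ => ?_
  obtain ⟨a, b⟩ := e
  have hab : ((a, b) = (i, j)) ↔ ((a : ℕ) = i ∧ (b : ℕ) = j) := by
    simp [Prod.ext_iff, Fin.ext_iff]
  simp only [hab]
  split_ifs <;> omega

/-- In the northwest corner rule, the mass of a corner is the smaller of the two marginal masses;
multiplicatively, this is a greatest common divisor. -/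
theorem IsStaircase.cornerProd_eq {x : Fin k × Fin k → ℕ} (hg : IsStaircase x) (i j : ℕ) :
    cornerProd x i j = Nat.gcd (initProd (rowProd x) i) (initProd (colProd x) j) := by
  rw [initProd_rowProd x i j, initProd_colProd x i j, Nat.gcd_mul_left]
  suffices h : Nat.Coprime (upperRightProd x i j) (lowerLeftProd x i j) by
    rw [h.gcd_eq_one, mul_one]
  refine Nat.Coprime.prod_left fun e _ => Nat.Coprime.prod_right fun f _ => ?_
  split_ifs with h1 h2
  · exact hg e f (Fin.lt_def.2 (by omega)) (Fin.lt_def.2 (by omega))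
  all_goals simp

/-- A staircase matrix is determined by its margins, since these determine the corner products. -/
theorem IsStaircase.ext {x y : Fin k × Fin k → ℕ} (hx : IsStaircase x) (hy : IsStaircase y)
    (hx0 : ∀ e, 0 < x e) (hr : rowProd x = rowProd y)
    (hc : colProd x = colProd y) : x = y := by
  have hC : ∀ i j, cornerProd x i j = cornerProd y i j := fun i j => by
    rw [hx.cornerProd_eq, hy.cornerProd_eq, hr, hc]
  funext ⟨i, j⟩
  have h1 := cornerProd_succ_succ x i j
  have h2 := cornerProd_succ_succ y i j
  simp only [← hC] at h2
  rw [h1] at h2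
  exact Nat.eq_of_mul_eq_mul_right
    (Nat.mul_pos (cornerProd_pos hx0 _ _) (cornerProd_pos hx0 _ _)) h2

/-- Supermodularity of the greatest common divisor. -/
theorem gcd_mul_gcd_dvd {a a' b b' : ℕ} (ha : a ∣ a') (hb : b ∣ b') :
    Nat.gcd a b' * Nat.gcd a' b ∣ Nat.gcd a' b' * Nat.gcd a b := by
  rw [← Nat.gcd_mul_left (Nat.gcd a' b')]
  refine Nat.dvd_gcd ?_ ?_
  · rw [mul_comm]
    exact mul_dvd_mul (Nat.gcd_dvd_gcd_of_dvd_right _ hb) (Nat.gcd_dvd_left _ _)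
  · exact mul_dvd_mul (Nat.gcd_dvd_gcd_of_dvd_left _ ha) (Nat.gcd_dvd_right _ _)

/-- Both blocks adjacent to a corner have coprime products, once the corner accounts for the whole
gcd of the partial row and column products. -/
theorem isStaircase_of_cornerProd_eq {x : Fin k × Fin k → ℕ} (hx : ∀ e, 0 < x e)
    (h : ∀ i j, i ≤ k → j ≤ k →
      cornerProd x i j = Nat.gcd (initProd (rowProd x) i) (initProd (colProd x) j)) :
    IsStaircase x := by
  intro e f h1 h2
  have h3 := h f.1 e.2 f.1.2.le e.2.2.le
  rw [initProd_rowProd x f.1 e.2, initProd_colProd x f.1 e.2, Nat.gcd_mul_left] at h3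
  have hcop : Nat.Coprime (upperRightProd x f.1 e.2) (lowerLeftProd x f.1 e.2) :=
    (Nat.eq_of_mul_eq_mul_left (cornerProd_pos hx _ _) (by rw [mul_one]; exact h3)).symm
  refine Nat.Coprime.of_dvd ?_ ?_ hcop
  · have := Finset.dvd_prod_of_mem
      (fun a : Fin k × Fin k => if (a.1 : ℕ) < f.1 ∧ ¬ (a.2 : ℕ) < e.2 then x a else 1)
      (Finset.mem_univ e)
    simpa [upperRightProd, h1] using this
  · have := Finset.dvd_prod_of_mem
      (fun a : Fin k × Fin k => if ¬ (a.1 : ℕ) < f.1 ∧ (a.2 : ℕ) < e.2 then x a else 1)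
      (Finset.mem_univ f)
    simpa [lowerLeftProd, h2] using this

/-- The northwest corner rule: the entries are the mixed multiplicative differences of the gcds of
the partial products, which are integers by supermodularity. -/
theorem exists_isStaircase {n m : Fin k → ℕ} (hn : ∀ i, 0 < n i) (hm : ∀ i, 0 < m i)
    (h : ∏ i, n i = ∏ i, m i) :
    ∃ x : Fin k × Fin k → ℕ, (∀ e, 0 < x e) ∧ IsStaircase x ∧ rowProd x = n ∧ colProd x = m := by
  set g : ℕ → ℕ → ℕ := fun i j => Nat.gcd (initProd n i) (initProd m j) with hg
  have gpos : ∀ i j, 0 < g i j := fun i j => Nat.gcd_pos_of_pos_left _ (initProd_pos hn i)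
  have hex : ∀ e : Fin k × Fin k, ∃ c, g (e.1 + 1) (e.2 + 1) * g e.1 e.2 =
      g e.1 (e.2 + 1) * g (e.1 + 1) e.2 * c := fun e =>
    gcd_mul_gcd_dvd (by rw [initProd_succ]; exact dvd_mul_right _ _)
      (by rw [initProd_succ]; exact dvd_mul_right _ _)
  choose x hx using hex
  have hx0 : ∀ e, 0 < x e := fun e => by
    have := Nat.mul_pos (gpos (e.1 + 1) (e.2 + 1)) (gpos e.1 e.2)
    rw [hx] at this
    exact Nat.pos_of_mul_pos_left this
  -- Both sides satisfy the same recursion with the same boundary values.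
  have hC : ∀ i, i ≤ k → ∀ j, j ≤ k → cornerProd x i j = g i j := by
    intro i
    induction i with
    | zero => intro _ j _; rw [cornerProd_zero_left]; simp [hg, initProd_zero]
    | succ i ihi =>
      intro hi j
      induction j with
      | zero => intro _; rw [cornerProd_zero_right]; simp [hg, initProd_zero]
      | succ j ihj =>
        intro hj
        have h1 := cornerProd_succ_succ x ⟨i, hi⟩ ⟨j, hj⟩
        have h2 := hx (⟨i, hi⟩, ⟨j, hj⟩)
        simp only at h1 h2
        rw [ihi (by omega) j (by omega), ihi (by omega) (j + 1) hj, ihj (by omega),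
          mul_comm (x _), ← h2] at h1
        exact Nat.eq_of_mul_eq_mul_right (gpos i j) h1
  have hrow : ∀ i, i ≤ k → initProd (rowProd x) i = initProd n i := by
    intro i hi
    have h1 : upperRightProd x i k = 1 := by simp [upperRightProd]
    have h2 : initProd n i ∣ initProd m k := by
      rw [initProd_full, ← h]
      unfold initProd
      exact Finset.prod_dvd_prod_of_dvd _ _ fun a _ => by split_ifs <;> simp
    rw [initProd_rowProd x i k, h1, mul_one, hC i hi k le_rfl]
    exact Nat.gcd_eq_left h2
  have hcol : ∀ i, i ≤ k → initProd (colProd x) i = initProd m i := by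
    intro i hi
    have h1 : lowerLeftProd x k i = 1 := by simp [lowerLeftProd]
    have h2 : initProd m i ∣ initProd n k := by
      rw [initProd_full, h]
      unfold initProd
      exact Finset.prod_dvd_prod_of_dvd _ _ fun a _ => by split_ifs <;> simp
    rw [initProd_colProd x k i, h1, mul_one, hC k le_rfl i hi]
    exact Nat.gcd_eq_right h2
  have key : ∀ u v : Fin k → ℕ, (∀ i, 0 < v i) → (∀ i, i ≤ k → initProd u i = initProd v i) →
      u = v := by
    intro u v hv huv
    funext i
    have h1 := huv (i + 1) i.2
    rw [initProd_succ, initProd_succ, huv i i.2.le] at h1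
    exact Nat.eq_of_mul_eq_mul_left (initProd_pos hv i) h1
  refine ⟨x, hx0, isStaircase_of_cornerProd_eq hx0 fun i j hi hj => ?_,
    key _ _ hn hrow, key _ _ hm hcol⟩
  rw [hC i hi j hj, hrow i hi, hcol j hj]

theorem prod_rowProd (x : Fin k × Fin k → ℕ) : ∏ i, rowProd x i = ∏ e, x e :=
  (Fintype.prod_prod_type _).symm

theorem prod_colProd (x : Fin k × Fin k → ℕ) : ∏ i, colProd x i = ∏ e, x e :=
  (Fintype.prod_prod_type_right _).symm

end

/-! ### Comparing product measures one coordinate at a time -/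

section

variable {K ι : Type*} [Fintype K] [DecidableEq K] [Fintype ι]

/-- The mass of the set `Q` under the product of the discrete measures `∑ n, w e n • δ (t e n)`. -/
noncomputable def productMass (Q : (K → ℝ) → Prop) [DecidablePred Q] (w t : K → ι → ℝ) : ℝ :=
  ∑ x : K → ι, (∏ e, w e (x e)) * if Q (fun e => t e (x e)) then 1 else 0

/-- The coordinate `e` is summed innermost, the other coordinates being fixed. -/
theorem productMass_eq_sum_coordinate (Q : (K → ℝ) → Prop) [DecidablePred Q] (w t : K → ι → ℝ)
    (e : K) :
    productMass Q w t = ∑ y : {f // f ≠ e} → ι, (∏ f : {f // f ≠ e}, w f (y f)) *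
      ∑ n, w e n * if Q (Function.update
        (fun f => if h : f ≠ e then t f (y ⟨f, h⟩) else 0) e (t e n)) then 1 else 0 := by
  unfold productMass
  rw [← Equiv.sum_comp (Equiv.funSplitAt e ι).symm, Fintype.sum_prod_type_right]
  refine Finset.sum_congr rfl fun y _ => ?_
  rw [Finset.mul_sum]
  refine Finset.sum_congr rfl fun n _ => ?_
  have h1 : (fun f => t f ((Equiv.funSplitAt e ι).symm (n, y) f)) = Function.update
        (fun f => if h : f ≠ e then t f (y ⟨f, h⟩) else 0) e (t e n) := by
    funext f
    by_cases h : f = e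
    · subst h; simp
    · simp [h, Equiv.funSplitAt]
  rw [h1, Fintype.prod_eq_mul_prod_subtype_ne _ e]
  have h2 : ∀ f : {f // f ≠ e}, (Equiv.funSplitAt e ι).symm (n, y) f = y f := fun f => by
    simp [Equiv.funSplitAt, f.2]
  have h3 : (Equiv.funSplitAt e ι).symm (n, y) e = n := by simp [Equiv.funSplitAt]
  simp only [h2, h3]
  ring

/-- Replacing the measure in the single coordinate `e`. -/
theorem abs_productMass_sub_le_of_eq_off (Q : (K → ℝ) → Prop) [DecidablePred Q]
    (w w' t t' : K → ι → ℝ) (e : K) (hw : ∀ f n, 0 ≤ w f n)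
    (hww : ∀ f, f ≠ e → w f = w' f) (htt : ∀ f, f ≠ e → t f = t' f) {C : K → ℝ} {E : ℝ}
    (hC : ∀ f, ∑ n, w f n ≤ C f)
    (hE : ∀ y : K → ℝ, |∑ n, (w e n * if Q (Function.update y e (t e n)) then 1 else 0) -
      ∑ n, (w' e n * if Q (Function.update y e (t' e n)) then 1 else 0)| ≤ E) :
    |productMass Q w t - productMass Q w' t'| ≤ E * ∏ f ∈ Finset.univ.erase e, C f := by
  have hE0 : 0 ≤ E := (abs_nonneg _).trans (hE 0)
  rw [productMass_eq_sum_coordinate Q w t e, productMass_eq_sum_coordinate Q w' t' e,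
    ← Finset.sum_sub_distrib]
  have h1 : ∏ f ∈ Finset.univ.erase e, C f = ∏ f : {f // f ≠ e}, C f := by
    rw [← Finset.prod_subtype_of_mem (p := fun f => f ≠ e) C
      (fun f hf => Finset.ne_of_mem_erase hf)]
    refine Finset.prod_congr ?_ fun _ _ => rfl
    ext f
    simp [f.2]
  have h2 : ∑ y : {f // f ≠ e} → ι, ∏ f : {f // f ≠ e}, w f (y f) ≤
      ∏ f ∈ Finset.univ.erase e, C f := by
    have := Finset.prod_univ_sum (fun _ : {f // f ≠ e} => (Finset.univ : Finset ι))
      (fun f n => w f n)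
    rw [Fintype.piFinset_univ] at this
    rw [← this, h1]
    exact Finset.prod_le_prod (fun f _ => Finset.sum_nonneg fun n _ => hw f n) fun f _ => hC f
  calc _ ≤ ∑ y : {f // f ≠ e} → ι, (∏ f : {f // f ≠ e}, w f (y f)) * E := by
        refine (Finset.abs_sum_le_sum_abs _ _).trans (Finset.sum_le_sum fun y _ => ?_)
        have h3 : ∏ f : {f // f ≠ e}, w' f (y f) = ∏ f : {f // f ≠ e}, w f (y f) :=
          Finset.prod_congr rfl fun f _ => by rw [hww f f.2]
        have h4 : (fun f => if h : f ≠ e then t' f (y ⟨f, h⟩) else 0) =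
            fun f => if h : f ≠ e then t f (y ⟨f, h⟩) else 0 := by
          funext f
          split_ifs with h
          · rw [htt f h]
          · rfl
        have h5 : 0 ≤ ∏ f : {f // f ≠ e}, w f (y f) := Finset.prod_nonneg fun f _ => hw f _
        rw [h3, h4, ← mul_sub, abs_mul, abs_of_nonneg h5]
        exact mul_le_mul_of_nonneg_left (hE _) h5
    _ ≤ _ := by
        rw [← Finset.sum_mul, mul_comm]
        exact mul_le_mul_of_nonneg_left h2 hE0

/-- If in every coordinate the two measures have total mass at most `C e` and nearly the same mass
on the sections of `Q`, then the product measures have nearly the same mass on `Q`. -/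
theorem abs_productMass_sub_le (Q : (K → ℝ) → Prop) [DecidablePred Q]
    (w w' t t' : K → ι → ℝ) (hw : ∀ f n, 0 ≤ w f n) (hw' : ∀ f n, 0 ≤ w' f n) {C E : K → ℝ}
    (hC : ∀ f, ∑ n, w f n ≤ C f) (hC' : ∀ f, ∑ n, w' f n ≤ C f)
    (hE : ∀ e, ∀ y : K → ℝ, |∑ n, (w e n * if Q (Function.update y e (t e n)) then 1 else 0) -
      ∑ n, (w' e n * if Q (Function.update y e (t' e n)) then 1 else 0)| ≤ E e) :
    |productMass Q w t - productMass Q w' t'| ≤ ∑ e, E e * ∏ f ∈ Finset.univ.erase e, C f := by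
  -- The coordinates in `s` already carry the second family of measures.
  have key : ∀ s : Finset K, |productMass Q w t - productMass Q (s.piecewise w' w)
      (s.piecewise t' t)| ≤ ∑ e ∈ s, E e * ∏ f ∈ Finset.univ.erase e, C f := by
    intro s
    induction s using Finset.induction_on with
    | empty => simp
    | insert e s hes ih =>
      rw [Finset.sum_insert hes, add_comm]
      refine (abs_sub_le _ (productMass Q (s.piecewise w' w) (s.piecewise t' t)) _).trans
        (add_le_add ih ?_)
      refine abs_productMass_sub_le_of_eq_off Q _ _ _ _ e ?_ ?_ ?_ ?_ ?_
      · intro f n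
        by_cases h : f ∈ s <;> simp [h, hw, hw']
      · intro f hf
        by_cases h : f ∈ s <;> simp [h, hf]
      · intro f hf
        by_cases h : f ∈ s <;> simp [h, hf]
      · intro f
        by_cases h : f ∈ s <;> simp [h, hC, hC']
      · simpa [hes] using hE e
  simpa using key Finset.univ

end

/-! ### Harmonic sums over multiples and lattice points of the polytope -/

section

/-- The sum of `r / x` over the multiples `x ≤ exp B` of `r` (with `x = n + 1`). -/
theorem sum_multiples_eq_harmonic {N r : ℕ} (hr : 0 < r) {B : ℝ} (hN : Real.exp B ≤ N) :
    ∑ n : Fin N, (if r ∣ (n : ℕ) + 1 then (r : ℝ) / ((n : ℕ) + 1) else 0) *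
      (if Real.log ((n : ℕ) + 1) ≤ B then (1 : ℝ) else 0) =
    (harmonic ⌊Real.exp B / r⌋₊ : ℝ) := by
  have hr' : (0 : ℝ) < r := by exact_mod_cast hr
  rw [Fin.sum_univ_eq_sum_range (fun n : ℕ => (if r ∣ n + 1 then (r : ℝ) / ((n : ℝ) + 1) else 0) *
      (if Real.log ((n : ℝ) + 1) ≤ B then (1 : ℝ) else 0)) N, harmonic]
  push_cast
  have hcond : ∀ n : ℕ, Real.log ((n : ℝ) + 1) ≤ B ↔ ((n : ℝ) + 1) ≤ Real.exp B := fun n =>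
    Real.log_le_iff_le_exp (by positivity)
  have h1 : ∀ n : ℕ, (if r ∣ n + 1 then (r : ℝ) / ((n : ℝ) + 1) else 0) *
      (if Real.log ((n : ℝ) + 1) ≤ B then (1 : ℝ) else 0) =
      if r ∣ n + 1 ∧ ((n : ℝ) + 1) ≤ Real.exp B then (r : ℝ) / ((n : ℝ) + 1) else 0 := fun n => by
    simp only [hcond]
    split_ifs <;> simp_all
  simp only [h1]
  rw [← Finset.sum_filter]
  symm
  refine Finset.sum_bij (fun y _ => r * (y + 1) - 1) ?_ ?_ ?_ ?_
  · intro y hy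
    have h2 : y + 1 ≤ ⌊Real.exp B / r⌋₊ := Finset.mem_range.1 hy
    have h3 : ((y + 1 : ℕ) : ℝ) ≤ Real.exp B / r :=
      (Nat.le_floor_iff (by positivity)).1 h2
    rw [le_div_iff₀ hr'] at h3
    have h4 : 0 < r * (y + 1) := by positivity
    have h5 : r * (y + 1) - 1 + 1 = r * (y + 1) := by omega
    have h6 : (((r * (y + 1) - 1 : ℕ) : ℝ) + 1) = r * (y + 1) := by exact_mod_cast h5
    have h7 : (r : ℝ) * (y + 1) ≤ Real.exp B := by push_cast at h3; linarith
    simp only [Finset.mem_filter, Finset.mem_range, h5, h6]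
    refine ⟨?_, dvd_mul_right _ _, h7⟩
    have : r * (y + 1) ≤ N := by exact_mod_cast h7.trans hN
    omega
  · intro a _ b _ h
    have ha : 0 < r * (a + 1) := by positivity
    have hb : 0 < r * (b + 1) := by positivity
    have : r * (a + 1) = r * (b + 1) := by omega
    have := Nat.eq_of_mul_eq_mul_left hr this
    omega
  · intro n hn
    simp only [Finset.mem_filter, Finset.mem_range] at hn
    obtain ⟨_, ⟨c, hc⟩, h2⟩ := hn
    have hc0 : 0 < c := by
      rcases Nat.eq_zero_or_pos c with h | h
      · simp [h] at hc
      · exact h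
    obtain ⟨d, rfl⟩ : ∃ d, c = d + 1 := ⟨c - 1, by omega⟩
    refine ⟨d, ?_, by omega⟩
    rw [Finset.mem_range, ← Nat.succ_le_iff, Nat.le_floor_iff (by positivity), le_div_iff₀ hr']
    have : ((n : ℝ) + 1) = r * (d + 1) := by exact_mod_cast hc
    push_cast
    linarith
  · intro y _
    have h4 : 0 < r * (y + 1) := by positivity
    have h5 : r * (y + 1) - 1 + 1 = r * (y + 1) := by omega
    have h6 : (((r * (y + 1) - 1 : ℕ) : ℝ) + 1) = r * (y + 1) := by exact_mod_cast h5
    rw [h6]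
    field_simp

theorem sum_multiples_le {N r : ℕ} (hr : 0 < r) {B : ℝ} (hB : 0 ≤ B) (hN : Real.exp B ≤ N) :
    ∑ n : Fin N, (if r ∣ (n : ℕ) + 1 then (r : ℝ) / ((n : ℕ) + 1) else 0) *
      (if Real.log ((n : ℕ) + 1) ≤ B then (1 : ℝ) else 0) ≤ 1 + B := by
  rw [sum_multiples_eq_harmonic hr hN]
  rcases Nat.eq_zero_or_pos ⌊Real.exp B / r⌋₊ with h | h
  · rw [h]; simp; linarith
  · refine (harmonic_le_one_add_log _).trans ?_
    have h1 : (⌊Real.exp B / r⌋₊ : ℝ) ≤ Real.exp B := (Nat.floor_le (by positivity)).trans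
      (div_le_self (by positivity) (by exact_mod_cast hr))
    have := (Real.log_le_iff_le_exp (by exact_mod_cast h)).2 h1
    linarith

theorem le_sum_multiples {N r : ℕ} (hr : 0 < r) {B : ℝ} (hN : Real.exp B ≤ N) :
    B - Real.log r ≤ ∑ n : Fin N, (if r ∣ (n : ℕ) + 1 then (r : ℝ) / ((n : ℕ) + 1) else 0) *
      (if Real.log ((n : ℕ) + 1) ≤ B then (1 : ℝ) else 0) := by
  have hr' : (0 : ℝ) < r := by exact_mod_cast hr
  rw [sum_multiples_eq_harmonic hr hN]
  refine le_trans ?_ (log_add_one_le_harmonic _)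
  have h1 : B - Real.log r = Real.log (Real.exp B / r) := by
    rw [Real.log_div (Real.exp_pos _).ne' hr'.ne', Real.log_exp]
  rw [h1]
  refine Real.log_le_log (by positivity) ?_
  push_cast
  exact (Nat.lt_floor_add_one _).le

theorem sum_fin_indicator_le_eq {N : ℕ} {B : ℝ} (hB : 0 ≤ B) (hN : Real.exp B ≤ N) :
    ∑ n : Fin N, (if ((n : ℕ) : ℝ) ≤ B then (1 : ℝ) else 0) = ⌊B⌋₊ + 1 := by
  rw [Fin.sum_univ_eq_sum_range (fun n : ℕ => if (n : ℝ) ≤ B then (1 : ℝ) else 0) N,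
    ← Finset.sum_filter, Finset.sum_const, nsmul_eq_mul, mul_one]
  have h1 : (Finset.range N).filter (fun n : ℕ => (n : ℝ) ≤ B) = Finset.range (⌊B⌋₊ + 1) := by
    ext n
    simp only [Finset.mem_filter, Finset.mem_range, Nat.lt_succ_iff, Nat.le_floor_iff hB]
    refine ⟨fun h => h.2, fun h => ⟨?_, h⟩⟩
    have : (n : ℝ) < N := by linarith [Real.add_one_le_exp B]
    exact_mod_cast this
  rw [h1, Finset.card_range]
  push_cast
  ring

/-- The mass of `[0, B]` under the measure placing `r / x` at `log x` for each multiple `x` of `r`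
differs by at most `1 + log r` from the number of integers in `[0, B]`. -/
theorem abs_sum_multiples_sub_le {N r : ℕ} (hr : 0 < r) {B : ℝ} (hN : Real.exp B ≤ N) :
    |∑ n : Fin N, (if r ∣ (n : ℕ) + 1 then (r : ℝ) / ((n : ℕ) + 1) else 0) *
        (if Real.log ((n : ℕ) + 1) ≤ B then (1 : ℝ) else 0) -
      ∑ n : Fin N, (if ((n : ℕ) : ℝ) ≤ B then (1 : ℝ) else 0)| ≤ 1 + Real.log r := by
  have hlr : 0 ≤ Real.log r := Real.log_natCast_nonneg r
  rcases lt_or_ge B 0 with hB | hB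
  · have h1 : ∀ n : Fin N, ¬ (Real.log ((n : ℕ) + 1) ≤ B) := fun n => by
      have : 0 ≤ Real.log ((n : ℕ) + 1) := Real.log_nonneg (by simp)
      linarith
    have h2 : ∀ n : Fin N, ¬ (((n : ℕ) : ℝ) ≤ B) := fun n => by
      have : (0 : ℝ) ≤ (n : ℕ) := Nat.cast_nonneg _
      linarith
    simp only [h1, h2, if_false, mul_zero, Finset.sum_const_zero, sub_zero, abs_zero]
    linarith
  · rw [sum_fin_indicator_le_eq hB hN, abs_le]
    have h1 := sum_multiples_le hr hB hN
    have h2 := le_sum_multiples hr hN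
    have h3 := Nat.floor_le hB
    have h4 := Nat.lt_floor_add_one B
    constructor <;> linarith

/-- The polytope of real matrices with `i`-th row sum at most `l i` and `j`-th column sum at most
`l j`. -/
def InPolytope {k : ℕ} (l : Fin k → ℝ) (y : Fin k × Fin k → ℝ) : Prop :=
  (∀ j, ∑ i, y (i, j) ≤ l j) ∧ ∀ i, ∑ j, y (i, j) ≤ l i

variable {k : ℕ}

theorem sum_row_update (y : Fin k × Fin k → ℝ) (e : Fin k × Fin k) (t : ℝ) (i : Fin k) :
    ∑ j, Function.update y e t (i, j) =
      if i = e.1 then t + ∑ j ∈ Finset.univ.erase e.2, y (i, j) else ∑ j, y (i, j) := by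
  split_ifs with h
  · rw [← Finset.add_sum_erase _ _ (Finset.mem_univ e.2)]
    subst h
    rw [Function.update_self]
    congr 1
    refine Finset.sum_congr rfl fun j hj => ?_
    rw [Function.update_of_ne]
    exact fun h => Finset.ne_of_mem_erase hj (congrArg Prod.snd h)
  · exact Finset.sum_congr rfl fun j _ =>
      Function.update_of_ne (fun h' => h (congrArg Prod.fst h')) _ _

theorem sum_col_update (y : Fin k × Fin k → ℝ) (e : Fin k × Fin k) (t : ℝ) (j : Fin k) :
    ∑ i, Function.update y e t (i, j) =
      if j = e.2 then t + ∑ i ∈ Finset.univ.erase e.1, y (i, j) else ∑ i, y (i, j) := by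
  split_ifs with h
  · rw [← Finset.add_sum_erase _ _ (Finset.mem_univ e.1)]
    subst h
    rw [Function.update_self]
    congr 1
    refine Finset.sum_congr rfl fun j hj => ?_
    rw [Function.update_of_ne]
    exact fun h => Finset.ne_of_mem_erase hj (congrArg Prod.fst h)
  · exact Finset.sum_congr rfl fun j _ =>
      Function.update_of_ne (fun h' => h (congrArg Prod.snd h')) _ _

/-- A section of the polytope in a coordinate direction is empty or a half-line. -/
theorem inPolytope_update (l : Fin k → ℝ) (y : Fin k × Fin k → ℝ) (e : Fin k × Fin k) :
    (∀ t, ¬ InPolytope l (Function.update y e t)) ∨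
      ∃ B, ∀ t, InPolytope l (Function.update y e t) ↔ t ≤ B := by
  by_cases h : (∀ j, j ≠ e.2 → ∑ i, y (i, j) ≤ l j) ∧ ∀ i, i ≠ e.1 → ∑ j, y (i, j) ≤ l i
  · refine Or.inr ⟨min (l e.2 - ∑ i ∈ Finset.univ.erase e.1, y (i, e.2))
      (l e.1 - ∑ j ∈ Finset.univ.erase e.2, y (e.1, j)), fun t => ?_⟩
    simp only [InPolytope, sum_row_update, sum_col_update, le_min_iff, le_sub_iff_add_le]
    refine ⟨fun ⟨h1, h2⟩ => ⟨by simpa using h1 e.2, by simpa using h2 e.1⟩, fun ⟨h1, h2⟩ =>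
      ⟨fun j => ?_, fun i => ?_⟩⟩
    · split_ifs with hj
      · subst hj; exact h1
      · exact h.1 j hj
    · split_ifs with hj
      · subst hj; exact h2
      · exact h.2 i hj
  · refine Or.inl fun t ht => h ?_
    simp only [InPolytope, sum_row_update, sum_col_update] at ht
    exact ⟨fun j hj => by simpa [hj] using ht.1 j, fun i hi => by simpa [hi] using ht.2 i⟩

theorem InPolytope.entry_le {l : Fin k → ℝ} {y : Fin k × Fin k → ℝ} (h : InPolytope l y)
    (hy : ∀ e, 0 ≤ y e) (e : Fin k × Fin k) : y e ≤ min (l e.1) (l e.2) := by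
  refine le_min ((Finset.single_le_sum (f := fun j => y (e.1, j)) (fun j _ => hy _)
    (Finset.mem_univ e.2)).trans (h.2 e.1)) ((Finset.single_le_sum (f := fun i => y (i, e.2))
    (fun j _ => hy _) (Finset.mem_univ e.1)).trans (h.1 e.2))

open Classical in
theorem pseudomagicCount_eq_sum (l : Fin k → ℝ) {N : ℕ} (hN : ∀ i, Real.exp (l i) ≤ N) :
    (pseudomagicCount l : ℝ) = ∑ x : Fin k × Fin k → Fin N,
      if InPolytope l (fun e => ((x e : ℕ) : ℝ)) then 1 else 0 := by
  rw [← Finset.sum_filter, Finset.sum_const, nsmul_eq_mul, mul_one, pseudomagicCount]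
  congr 1
  rw [← Set.ncard_coe_finset]
  symm
  refine Set.ncard_congr (fun x _ => fun i j => (x (i, j) : ℕ)) ?_ ?_ ?_
  · intro x hx
    simp only [Finset.coe_filter, Finset.mem_univ, true_and, Set.mem_ofPred_eq] at hx
    exact hx
  · intro x y _ _ h
    funext ⟨i, j⟩
    exact Fin.ext (congrFun (congrFun h i) j)
  · intro x hx
    have hx' : InPolytope l (fun e => ((x e.1 e.2 : ℕ) : ℝ)) := hx
    have hlt : ∀ e : Fin k × Fin k, x e.1 e.2 < N := fun e => by
      have h1 := hx'.entry_le (fun _ => Nat.cast_nonneg _) e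
      have h2 := Real.add_one_le_exp (l e.1)
      have : ((x e.1 e.2 : ℕ) : ℝ) < N := by linarith [hN e.1, h1.trans (min_le_left _ _)]
      exact_mod_cast this
    refine ⟨fun e => ⟨x e.1 e.2, hlt e⟩, ?_, rfl⟩
    simp only [Finset.coe_filter, Finset.mem_univ, true_and, Set.mem_ofPred_eq]
    exact hx'

open Classical in
/-- The logarithmic sum over the matrices `x` with `r e ∣ x e` and with bounded row and column
products is approximated by the number of lattice points of the polytope. -/
theorem abs_sum_dvd_sub_pseudomagicCount_le {l : Fin k → ℝ} (hl : ∀ i, 0 ≤ l i) {N : ℕ}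
    (hN : ∀ i, Real.exp (l i) ≤ N) {r : Fin k × Fin k → ℕ} (hr : ∀ e, 0 < r e) :
    |∑ x : Fin k × Fin k → Fin N,
        (∏ e, if r e ∣ (x e : ℕ) + 1 then (r e : ℝ) / ((x e : ℕ) + 1) else 0) *
        (if InPolytope l (fun e => Real.log ((x e : ℕ) + 1)) then 1 else 0) -
      pseudomagicCount l| ≤
    ∑ e, (1 + Real.log (r e)) *
      ∏ f ∈ Finset.univ.erase e, (1 + min (l f.1) (l f.2)) := by
  set b : Fin k × Fin k → ℝ := fun e => min (l e.1) (l e.2) with hb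
  have hb0 : ∀ e, 0 ≤ b e := fun e => le_min (hl _) (hl _)
  have hbN : ∀ e, Real.exp (b e) ≤ N := fun e =>
    (Real.exp_le_exp.2 (min_le_left _ _)).trans (hN e.1)
  -- Both weights are cut off at the largest value an entry can take in the polytope, which makes
  -- the total masses finite uniformly in `N`.
  set w : Fin k × Fin k → Fin N → ℝ := fun e n =>
    (if r e ∣ (n : ℕ) + 1 then (r e : ℝ) / ((n : ℕ) + 1) else 0) *
      (if Real.log ((n : ℕ) + 1) ≤ b e then 1 else 0) with hw
  set w' : Fin k × Fin k → Fin N → ℝ := fun e n => if ((n : ℕ) : ℝ) ≤ b e then 1 else 0 with hw'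
  set t : Fin k × Fin k → Fin N → ℝ := fun e n => Real.log ((n : ℕ) + 1) with ht
  set t' : Fin k × Fin k → Fin N → ℝ := fun e n => ((n : ℕ) : ℝ) with ht'
  have ht0 : ∀ e n, 0 ≤ t e n := fun e n => Real.log_nonneg (by simp)
  have ht0' : ∀ e n, 0 ≤ t' e n := fun e n => Nat.cast_nonneg _
  have h1 : productMass (InPolytope l) w t = ∑ x : Fin k × Fin k → Fin N,
        (∏ e, if r e ∣ (x e : ℕ) + 1 then (r e : ℝ) / ((x e : ℕ) + 1) else 0) *
        (if InPolytope l (fun e => Real.log ((x e : ℕ) + 1)) then 1 else 0) := by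
    refine Finset.sum_congr rfl fun x _ => ?_
    by_cases h : InPolytope l (fun e => t e (x e))
    · have h2 := h.entry_le fun e => ht0 e (x e)
      have h3 : ∀ e, w e (x e) =
          if r e ∣ (x e : ℕ) + 1 then (r e : ℝ) / ((x e : ℕ) + 1) else 0 := fun e => by
        simp only [hw]
        rw [if_pos (h2 e), mul_one]
      simp only [h3, ht]
    · rw [if_neg h, mul_zero, mul_zero]
  have h2 : productMass (InPolytope l) w' t' = pseudomagicCount l := by
    rw [pseudomagicCount_eq_sum l hN]
    refine Finset.sum_congr rfl fun x _ => ?_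
    by_cases h : InPolytope l (fun e => t' e (x e))
    · have h2 := h.entry_le fun e => ht0' e (x e)
      have h3 : ∀ e, w' e (x e) = 1 := fun e => if_pos (h2 e)
      simp only [h3, ht', Finset.prod_const_one, one_mul]
    · rw [if_neg h, mul_zero]
  rw [← h1, ← h2]
  refine abs_productMass_sub_le (InPolytope l) w w' t t' ?_ ?_ ?_ ?_ ?_
  · intro e n
    simp only [hw]
    positivity
  · intro e n
    simp only [hw']
    positivity
  · intro e
    exact sum_multiples_le (hr e) (hb0 e) (hbN e)
  · intro e
    simp only [hw']
    rw [sum_fin_indicator_le_eq (hb0 e) (hbN e)]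
    linarith [Nat.floor_le (hb0 e)]
  · intro e y
    rcases inPolytope_update l y e with h | ⟨B, h⟩
    · simp only [h, if_false, mul_zero, Finset.sum_const_zero, sub_zero, abs_zero]
      linarith [Real.log_natCast_nonneg (r e)]
    · have hcut : ∀ s : ℝ, (if s ≤ b e then (1 : ℝ) else 0) * (if s ≤ B then 1 else 0) =
          if s ≤ min (b e) B then 1 else 0 := fun s => by
        rw [ite_zero_mul_ite_zero, mul_one]
        simp only [_root_.le_min_iff]
      simp only [h, hw, hw', ht, ht', mul_assoc, hcut]
      exact abs_sum_multiples_sub_le (hr e) (B := min (b e) B)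
        ((Real.exp_le_exp.2 (min_le_left _ _)).trans (hbN e))

end

/-! ### Sieving for the staircase condition -/

section

/-- The pairs of cells `(e, f)` of a `k × k` matrix with `e` strictly above and strictly to the
right of `f`. -/
def crossingPairs (k : ℕ) : Finset ((Fin k × Fin k) × (Fin k × Fin k)) :=
  Finset.univ.filter fun π => π.1.1 < π.2.1 ∧ π.2.2 < π.1.2

/-- The cells that occur in a set of pairs of cells. -/
def cells {k : ℕ} (U : Finset ((Fin k × Fin k) × (Fin k × Fin k))) : Finset (Fin k × Fin k) :=
  U.image Prod.fst ∪ U.image Prod.snd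

/-- The probability that, in a random matrix of positive integers, the entries divisible by `p`
contain no crossing pair, written out by inclusion-exclusion over sets of crossing pairs. -/
noncomputable def localDensity (k p : ℕ) : ℝ :=
  ∑ U ∈ (crossingPairs k).powerset, (-1) ^ U.card / (p : ℝ) ^ (cells U).card

variable {k : ℕ}

theorem cells_empty : cells (∅ : Finset ((Fin k × Fin k) × (Fin k × Fin k))) = ∅ := by
  simp [cells]

theorem forall_mem_cells {U : Finset ((Fin k × Fin k) × (Fin k × Fin k))}
    {P : Fin k × Fin k → Prop} : (∀ e ∈ cells U, P e) ↔ ∀ π ∈ U, P π.1 ∧ P π.2 := by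
  simp only [cells, Finset.mem_union, Finset.mem_image]
  constructor
  · exact fun h π hπ => ⟨h _ (Or.inl ⟨π, hπ, rfl⟩), h _ (Or.inr ⟨π, hπ, rfl⟩)⟩
  · rintro h e (⟨π, hπ, rfl⟩ | ⟨π, hπ, rfl⟩)
    exacts [(h π hπ).1, (h π hπ).2]

theorem two_le_card_cells {U : Finset ((Fin k × Fin k) × (Fin k × Fin k))}
    (hU : U ⊆ crossingPairs k) (hne : U.Nonempty) : 2 ≤ (cells U).card := by
  obtain ⟨π, hπ⟩ := hne
  have h1 := (Finset.mem_filter.1 (hU hπ)).2.1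
  have h2 : ({π.1, π.2} : Finset (Fin k × Fin k)) ⊆ cells U := by
    intro e he
    have h3 := (forall_mem_cells (P := fun e => e ∈ cells U)).1 (fun _ h => h) π hπ
    rcases Finset.mem_insert.1 he with rfl | he
    · exact h3.1
    · rw [Finset.mem_singleton.1 he]; exact h3.2
  rw [← Finset.card_pair (fun h => h1.ne (congrArg Prod.fst h) : π.1 ≠ π.2)]
  exact Finset.card_le_card h2

/-- Inclusion-exclusion over the crossing pairs on which `P` holds. -/
theorem sum_powerset_crossingPairs (P : Fin k × Fin k → Prop) [DecidablePred P] :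
    ∑ U ∈ (crossingPairs k).powerset, (-1 : ℝ) ^ U.card * (if ∀ e ∈ cells U, P e then 1 else 0) =
      if ∀ π ∈ crossingPairs k, ¬ (P π.1 ∧ P π.2) then 1 else 0 := by
  have h1 : (if ∀ π ∈ crossingPairs k, ¬ (P π.1 ∧ P π.2) then (1 : ℝ) else 0) =
      ∏ π ∈ crossingPairs k, (1 + if P π.1 ∧ P π.2 then (-1 : ℝ) else 0) := by
    split_ifs with h
    · symm
      exact Finset.prod_eq_one fun π hπ => by rw [if_neg (h π hπ), add_zero]
    · push Not at h
      obtain ⟨π, hπ, h⟩ := h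
      symm
      exact Finset.prod_eq_zero hπ (by rw [if_pos h, add_neg_cancel])
  rw [h1, Finset.prod_one_add]
  refine Finset.sum_congr rfl fun U _ => ?_
  rw [Finset.prod_ite_zero, Finset.prod_const]
  simp only [forall_mem_cells, mul_ite, mul_one, mul_zero]
  split_ifs <;> rfl

open Classical in
/-- The staircase condition is a condition at each prime. -/
theorem indicator_isStaircase_eq_prod {x : Fin k × Fin k → ℕ} {S : Finset Nat.Primes}
    (hS : ∀ p : Nat.Primes, ∀ e, (p : ℕ) ∣ x e → p ∈ S) :
    (if IsStaircase x then (1 : ℝ) else 0) = ∏ p ∈ S, ∑ U ∈ (crossingPairs k).powerset,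
      (-1 : ℝ) ^ U.card * (if ∀ e ∈ cells U, (p : ℕ) ∣ x e then 1 else 0) := by
  rw [Finset.prod_congr rfl fun (p : Nat.Primes) _ =>
    sum_powerset_crossingPairs (fun e => (p : ℕ) ∣ x e)]
  rw [Finset.prod_ite_zero, Finset.prod_const_one]
  congr 1
  refine propext ⟨fun h p _ π hπ hp => ?_, fun h e f h1 h2 => ?_⟩
  · have h1 := (Finset.mem_filter.1 hπ).2
    exact Nat.Prime.not_coprime_iff_dvd.2 ⟨p, p.2, hp⟩ (h _ _ h1.1 h1.2)
  · by_contra hc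
    obtain ⟨p, hp, hpe, hpf⟩ := Nat.Prime.not_coprime_iff_dvd.1 hc
    exact h ⟨p, hp⟩ (hS _ e hpe) (e, f) (Finset.mem_filter.2 ⟨Finset.mem_univ _, h1, h2⟩)
      ⟨hpe, hpf⟩

/-- The product of the primes `p ∈ S` for which the cell `e` occurs in `V p`. -/
def sieveModulus {S : Finset Nat.Primes} (V : S → Finset ((Fin k × Fin k) × (Fin k × Fin k)))
    (e : Fin k × Fin k) : ℕ :=
  ∏ p : S, if e ∈ cells (V p) then ((p : Nat.Primes) : ℕ) else 1

variable {S : Finset Nat.Primes}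

theorem sieveModulus_pos (V : S → Finset ((Fin k × Fin k) × (Fin k × Fin k)))
    (e : Fin k × Fin k) : 0 < sieveModulus V e := by
  refine Finset.prod_pos fun p _ => ?_
  split_ifs
  exacts [(p : Nat.Primes).2.pos, one_pos]

theorem prod_sieveModulus (V : S → Finset ((Fin k × Fin k) × (Fin k × Fin k))) :
    ∏ e, sieveModulus V e = ∏ p : S, ((p : Nat.Primes) : ℕ) ^ (cells (V p)).card := by
  unfold sieveModulus
  rw [Finset.prod_comm]
  refine Finset.prod_congr rfl fun p _ => ?_
  rw [Finset.prod_ite_mem, Finset.univ_inter, Finset.prod_const]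

theorem sieveModulus_dvd_iff (V : S → Finset ((Fin k × Fin k) × (Fin k × Fin k)))
    (x : Fin k × Fin k → ℕ) :
    (∀ p : S, ∀ e ∈ cells (V p), ((p : Nat.Primes) : ℕ) ∣ x e) ↔
      ∀ e, sieveModulus V e ∣ x e := by
  constructor
  · intro h e
    refine Fintype.prod_dvd_of_isRelPrime (fun p q hpq => ?_) fun p => ?_
    · have : Nat.Coprime ((p : Nat.Primes) : ℕ) ((q : Nat.Primes) : ℕ) :=
        (Nat.coprime_primes (p : Nat.Primes).2 (q : Nat.Primes).2).2
          fun h => hpq (Subtype.ext (Subtype.ext h))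
      simp only [Function.onFun]
      rw [← Nat.coprime_iff_isRelPrime]
      split_ifs
      exacts [this, Nat.coprime_one_right _, Nat.coprime_one_left _, Nat.coprime_one_left _]
    · split_ifs with hp
      exacts [h p e hp, one_dvd _]
  · intro h p e he
    refine dvd_trans ?_ (h e)
    have := Finset.dvd_prod_of_mem
      (fun p : S => if e ∈ cells (V p) then ((p : Nat.Primes) : ℕ) else 1) (Finset.mem_univ p)
    simpa [he, sieveModulus] using this

open Classical in
/-- The sum of the reciprocals of the products of all entries, over the staircase matrices in the
multiplicative polytope with side lengths `exp (l i)`; entries are written `x + 1` with `x < N`. -/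
noncomputable def staircaseSum (l : Fin k → ℝ) (N : ℕ) : ℝ :=
  ∑ x : Fin k × Fin k → Fin N, (if IsStaircase (fun e => (x e : ℕ) + 1) then 1 else 0) *
    ((∏ e, 1 / (((x e : ℕ) : ℝ) + 1)) *
      if InPolytope l (fun e => Real.log ((x e : ℕ) + 1)) then 1 else 0)

open Classical in
/-- Multiplying out the indicators at the primes of `S` turns the staircase condition into
divisibility conditions on the single entries. -/
theorem staircaseSum_eq_sum_sieve (l : Fin k → ℝ) {N : ℕ}
    (hS : ∀ p : Nat.Primes, (p : ℕ) ≤ N → p ∈ S) :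
    staircaseSum l N = ∑ V ∈ Fintype.piFinset fun _ : S => (crossingPairs k).powerset,
      (∏ p : S, (-1 : ℝ) ^ (V p).card / ((p : Nat.Primes) : ℝ) ^ (cells (V p)).card) *
      ∑ x : Fin k × Fin k → Fin N,
        (∏ e, if sieveModulus V e ∣ (x e : ℕ) + 1 then
          (sieveModulus V e : ℝ) / ((x e : ℕ) + 1) else 0) *
        (if InPolytope l (fun e => Real.log ((x e : ℕ) + 1)) then 1 else 0) := by
  simp only [Finset.mul_sum]
  rw [Finset.sum_comm]
  refine Finset.sum_congr rfl fun x _ => ?_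
  have hx : ∀ p : Nat.Primes, ∀ e, (p : ℕ) ∣ (x e : ℕ) + 1 → p ∈ S := fun p e h =>
    hS p ((Nat.le_of_dvd (Nat.succ_pos _) h).trans (x e).2)
  rw [indicator_isStaircase_eq_prod hx, ← Finset.prod_coe_sort, Finset.prod_univ_sum,
    Finset.sum_mul]
  refine Finset.sum_congr rfl fun V _ => ?_
  simp only [← mul_assoc]
  congr 1
  have hpos : ∀ e, (sieveModulus V e : ℝ) ≠ 0 := fun e => by
    exact_mod_cast (sieveModulus_pos V e).ne'
  rw [Finset.prod_div_distrib, Finset.prod_mul_distrib, Finset.prod_ite_zero, Finset.prod_ite_zero,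
    Finset.prod_const_one, Finset.prod_div_distrib, Finset.prod_div_distrib,
    Finset.prod_const_one]
  have h1 : (∏ e, (sieveModulus V e : ℝ)) =
      ∏ p : S, ((p : Nat.Primes) : ℝ) ^ (cells (V p)).card := by
    exact_mod_cast congrArg (Nat.cast : ℕ → ℝ) (prod_sieveModulus V)
  rw [← h1]
  have h2 := sieveModulus_dvd_iff V fun e => (x e : ℕ) + 1
  have h3 : (∏ e, (sieveModulus V e : ℝ)) ≠ 0 := Finset.prod_ne_zero_iff.2 fun e _ => hpos e
  by_cases h : ∀ e, sieveModulus V e ∣ (x e : ℕ) + 1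
  · rw [if_pos (fun p _ => h2.2 h p), if_pos (fun e _ => h e)]
    field_simp
  · rw [if_neg (fun h' => h (h2.1 fun p => h' p (Finset.mem_univ p))),
      if_neg (fun h' => h fun e => h' e (Finset.mem_univ e))]
    simp

theorem prod_localDensity_eq_sum (k : ℕ) (S : Finset Nat.Primes) :
    ∏ p ∈ S, localDensity k p = ∑ V ∈ Fintype.piFinset fun _ : S => (crossingPairs k).powerset,
      ∏ p : S, (-1 : ℝ) ^ (V p).card / ((p : Nat.Primes) : ℝ) ^ (cells (V p)).card := by
  rw [← Finset.prod_coe_sort]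
  exact Finset.prod_univ_sum _ _

/-- The main error term: for each cell `e`, the product of the side lengths of the polytope in the
directions of all other cells. -/
noncomputable def polytopeError (l : Fin k → ℝ) : ℝ :=
  ∑ e : Fin k × Fin k, ∏ f ∈ Finset.univ.erase e, (1 + min (l f.1) (l f.2))

theorem polytopeError_nonneg {l : Fin k → ℝ} (hl : ∀ i, 0 ≤ l i) : 0 ≤ polytopeError l :=
  Finset.sum_nonneg fun _ _ => Finset.prod_nonneg fun _ _ =>
    add_nonneg zero_le_one (le_min (hl _) (hl _))

theorem one_add_log_le_rpow {y : ℝ} (hy : 1 ≤ y) : 1 + Real.log y ≤ 4 * y ^ (1 / 4 : ℝ) := by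
  have h1 := Real.log_le_rpow_div (zero_le_one.trans hy) (show (0 : ℝ) < 1 / 4 by norm_num)
  have h2 := Real.add_one_le_exp (1 / 4 * Real.log y)
  have h3 : y ^ (1 / 4 : ℝ) = Real.exp (1 / 4 * Real.log y) := by
    rw [Real.rpow_def_of_pos (by linarith), mul_comm]
  rw [h3]
  linarith

/-- The factor `1 + log r` lost for each modulus is absorbed by a small power of the product of all
moduli, so that the error is again a product over the primes. -/
theorem abs_staircaseSum_sub_le_prod {l : Fin k → ℝ} (hl : ∀ i, 0 ≤ l i) {N : ℕ}
    (hN : ∀ i, Real.exp (l i) ≤ N) (hS : ∀ p : Nat.Primes, (p : ℕ) ≤ N → p ∈ S) :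
    |staircaseSum l N - (∏ p ∈ S, localDensity k p) * pseudomagicCount l| ≤
      4 * polytopeError l * ∏ p ∈ S, ∑ U ∈ (crossingPairs k).powerset,
        ((p : ℕ) : ℝ) ^ (-(3 / 4) * ((cells U).card : ℝ)) := by
  rw [staircaseSum_eq_sum_sieve l hS, prod_localDensity_eq_sum, Finset.sum_mul,
    ← Finset.sum_sub_distrib]
  simp only [← mul_sub]
  rw [← Finset.prod_coe_sort S (fun p : Nat.Primes => ∑ U ∈ (crossingPairs k).powerset,
        ((p : ℕ) : ℝ) ^ (-(3 / 4) * ((cells U).card : ℝ))), Finset.prod_univ_sum, Finset.mul_sum]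
  refine (Finset.abs_sum_le_sum_abs _ _).trans (Finset.sum_le_sum fun V _ => ?_)
  rw [abs_mul]
  set R : ℝ := ∏ p : S, ((p : Nat.Primes) : ℝ) ^ (cells (V p)).card with hR
  have hpp : ∀ p : S, (0 : ℝ) < ((p : Nat.Primes) : ℕ) := fun p => by
    exact_mod_cast (p : Nat.Primes).2.pos
  have hRn : R = ((∏ e, sieveModulus V e : ℕ) : ℝ) := by
    rw [prod_sieveModulus, hR]; push_cast; rfl
  have hR1 : 1 ≤ R := by
    rw [hRn]
    exact_mod_cast Nat.one_le_iff_ne_zero.2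
      (Finset.prod_ne_zero_iff.2 fun e _ => (sieveModulus_pos V e).ne')
  have h1 : |∏ p : S, (-1 : ℝ) ^ (V p).card / ((p : Nat.Primes) : ℝ) ^ (cells (V p)).card| =
      R⁻¹ := by
    rw [Finset.prod_div_distrib, abs_div, Finset.abs_prod, ← hR,
      abs_of_nonneg (by linarith : 0 ≤ R)]
    simp
  have h2 : ∀ e, 1 + Real.log (sieveModulus V e) ≤ 4 * R ^ (1 / 4 : ℝ) := fun e => by
    refine le_trans ?_ (one_add_log_le_rpow hR1)
    have h3 : sieveModulus V e ≤ ∏ e, sieveModulus V e :=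
      Finset.single_le_prod' (f := sieveModulus V) (fun e _ => sieveModulus_pos V e)
        (Finset.mem_univ e)
    have h4 : (sieveModulus V e : ℝ) ≤ R := by rw [hRn]; exact_mod_cast h3
    have := Real.log_le_log (by exact_mod_cast sieveModulus_pos V e) h4
    linarith
  have h3 : ∏ p : S, (((p : Nat.Primes) : ℕ) : ℝ) ^ (-(3 / 4) * ((cells (V p)).card : ℝ)) =
      R⁻¹ * R ^ (1 / 4 : ℝ) := by
    have h4 : R⁻¹ * R ^ (1 / 4 : ℝ) = R ^ (-(3 / 4) : ℝ) := by
      rw [← Real.rpow_neg_one, ← Real.rpow_add (by linarith)]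
      norm_num
    rw [h4, hR, ← Real.finsetProd_rpow _ _ (fun p _ => by positivity)]
    refine Finset.prod_congr rfl fun p _ => ?_
    rw [mul_comm, Real.rpow_mul (hpp p).le, Real.rpow_natCast]
  rw [h1, h3]
  calc _ ≤ R⁻¹ * ∑ e, (1 + Real.log (sieveModulus V e)) *
        ∏ f ∈ Finset.univ.erase e, (1 + min (l f.1) (l f.2)) :=
        mul_le_mul_of_nonneg_left
          (abs_sum_dvd_sub_pseudomagicCount_le hl hN (sieveModulus_pos V)) (by positivity)
    _ ≤ R⁻¹ * ∑ e : Fin k × Fin k, (4 * R ^ (1 / 4 : ℝ)) *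
        ∏ f ∈ Finset.univ.erase e, (1 + min (l f.1) (l f.2)) := by
        refine mul_le_mul_of_nonneg_left (Finset.sum_le_sum fun e _ => ?_) (by positivity)
        exact mul_le_mul_of_nonneg_right (h2 e) (Finset.prod_nonneg fun f _ =>
          add_nonneg zero_le_one (le_min (hl _) (hl _)))
    _ = _ := by
        rw [← Finset.mul_sum, polytopeError]
        ring

theorem sum_powerset_rpow_le (k : ℕ) (p : Nat.Primes) :
    ∑ U ∈ (crossingPairs k).powerset, ((p : ℕ) : ℝ) ^ (-(3 / 4) * ((cells U).card : ℝ)) ≤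
      1 + 2 ^ (crossingPairs k).card * ((p : ℕ) : ℝ) ^ (-(3 / 2) : ℝ) := by
  have hp : (1 : ℝ) ≤ (p : ℕ) := by exact_mod_cast p.2.one_le
  rw [← Finset.add_sum_erase _ _ (Finset.empty_mem_powerset _), cells_empty]
  simp only [Finset.card_empty, Nat.cast_zero, mul_zero, Real.rpow_zero]
  refine add_le_add le_rfl ?_
  refine (Finset.sum_le_card_nsmul _ _ (((p : ℕ) : ℝ) ^ (-(3 / 2) : ℝ)) fun U hU => ?_).trans ?_
  · obtain ⟨h1, h2⟩ := Finset.mem_erase.1 hU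
    have h3 := two_le_card_cells (Finset.mem_powerset.1 h2) (Finset.nonempty_iff_ne_empty.2 h1)
    have h4 : (2 : ℝ) ≤ (cells U).card := by exact_mod_cast h3
    exact Real.rpow_le_rpow_of_exponent_le hp (by linarith)
  · rw [nsmul_eq_mul]
    refine mul_le_mul_of_nonneg_right ?_ (by positivity)
    rw [← Nat.cast_two, ← Nat.cast_pow, ← Finset.card_powerset]
    exact_mod_cast Finset.card_erase_le

/-- The error constant is uniform in the sieving set of primes, because `∑ p ^ (-3/2)` converges. -/
theorem exists_abs_staircaseSum_sub_le (k : ℕ) : ∃ C : ℝ, 0 ≤ C ∧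
    ∀ (l : Fin k → ℝ) (N : ℕ) (S : Finset Nat.Primes), (∀ i, 0 ≤ l i) →
      (∀ i, Real.exp (l i) ≤ N) → (∀ p : Nat.Primes, (p : ℕ) ≤ N → p ∈ S) →
      |staircaseSum l N - (∏ p ∈ S, localDensity k p) * pseudomagicCount l| ≤
        C * polytopeError l := by
  have hsum : Summable fun p : Nat.Primes =>
      (2 : ℝ) ^ (crossingPairs k).card * ((p : ℕ) : ℝ) ^ (-(3 / 2) : ℝ) :=
    (Nat.Primes.summable_rpow.2 (by norm_num)).mul_left _
  refine ⟨4 * Real.exp (∑' p : Nat.Primes,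
    (2 : ℝ) ^ (crossingPairs k).card * ((p : ℕ) : ℝ) ^ (-(3 / 2) : ℝ)), by positivity,
    fun l N S hl hN hS => (abs_staircaseSum_sub_le_prod hl hN hS).trans ?_⟩
  have h1 : ∏ p ∈ S, ∑ U ∈ (crossingPairs k).powerset,
      ((p : ℕ) : ℝ) ^ (-(3 / 4) * ((cells U).card : ℝ)) ≤ Real.exp (∑' p : Nat.Primes,
    (2 : ℝ) ^ (crossingPairs k).card * ((p : ℕ) : ℝ) ^ (-(3 / 2) : ℝ)) := by
    calc _ ≤ ∏ p ∈ S, Real.exp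
          ((2 : ℝ) ^ (crossingPairs k).card * ((p : ℕ) : ℝ) ^ (-(3 / 2) : ℝ)) := by
          refine Finset.prod_le_prod (fun p _ => Finset.sum_nonneg fun U _ => by positivity)
            fun p _ => (sum_powerset_rpow_le k p).trans ?_
          rw [add_comm]
          exact Real.add_one_le_exp _
      _ ≤ _ := by
          rw [← Real.exp_sum]
          exact Real.exp_le_exp.2 (hsum.sum_le_tsum S fun p _ => by positivity)
  have := mul_le_mul_of_nonneg_left h1 (mul_nonneg (by norm_num : (0 : ℝ) ≤ 4)
    (polytopeError_nonneg hl))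
  linarith

end

/-! ### The local factors and the arithmetic factor -/

section

theorem hasSum_fin_prod {d : ℕ} {f : Fin d → ℕ → ℝ} {a : Fin d → ℝ} (hf0 : ∀ i n, 0 ≤ f i n)
    (hf : ∀ i, HasSum (f i) (a i)) :
    HasSum (fun v : Fin d → ℕ => ∏ i, f i (v i)) (∏ i, a i) := by
  induction d with
  | zero => simp
  | succ d ih =>
    have h1 := ih (f := fun i => f i.succ) (a := fun i => a i.succ) (fun i n => hf0 _ n)
      fun i => hf _
    have h2 := Summable.mul_of_nonneg (f := f 0)
      (g := fun v : Fin d → ℕ => ∏ i, f (Fin.succ i) (v i)) (hf 0).summable h1.summable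
      (fun n => hf0 0 n) fun v => Finset.prod_nonneg fun i _ => hf0 _ _
    have h3 := HasSum.mul (f := f 0) (g := fun v : Fin d → ℕ => ∏ i, f (Fin.succ i) (v i))
      (hf 0) h1 h2
    rw [← Fin.prod_univ_succ] at h3
    refine ((Fin.consEquiv fun _ : Fin (d + 1) => ℕ).hasSum_iff).1 ?_
    have h4 : (fun v : Fin (d + 1) → ℕ => ∏ i, f i (v i)) ∘ (Fin.consEquiv fun _ => ℕ) =
        fun x => f 0 x.1 * ∏ i, f (Fin.succ i) (x.2 i) := by
      funext x
      simp [Fin.consEquiv, Fin.prod_univ_succ]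
    rw [h4]
    exact h3

/-- A product of convergent nonnegative series, multiplied out over a finite index type. -/
theorem hasSum_pi_prod {K : Type*} [Fintype K] {f : K → ℕ → ℝ} {a : K → ℝ}
    (hf0 : ∀ i n, 0 ≤ f i n) (hf : ∀ i, HasSum (f i) (a i)) :
    HasSum (fun v : K → ℕ => ∏ i, f i (v i)) (∏ i, a i) := by
  have e := (Fintype.equivFin K).symm
  have h := hasSum_fin_prod (fun i n => hf0 (e i) n) fun i => hf (e i)
  rw [← (Equiv.arrowCongr e.symm (Equiv.refl ℕ)).hasSum_iff] at h
  rw [e.prod_comp a] at h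
  convert h using 2 with v
  simp only [Function.comp, Equiv.arrowCongr_apply, Equiv.symm_symm, Equiv.coe_refl, id]
  exact (e.prod_comp fun i => f i (v i)).symm

variable {k : ℕ}

theorem isStaircase_prime_pow_iff {p : ℕ} (hp : p.Prime) (v : Fin k × Fin k → ℕ) :
    IsStaircase (fun e => p ^ v e) ↔ ∀ π ∈ crossingPairs k, ¬ (v π.1 ≠ 0 ∧ v π.2 ≠ 0) := by
  have h : ∀ a b : ℕ, Nat.Coprime (p ^ a) (p ^ b) ↔ ¬ (a ≠ 0 ∧ b ≠ 0) := fun a b => by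
    constructor
    · rintro h ⟨ha, hb⟩
      exact Nat.Prime.not_coprime_iff_dvd.2 ⟨p, hp, dvd_pow_self p ha, dvd_pow_self p hb⟩ h
    · intro h
      rcases not_and_or.1 h with h | h
      · simp [not_not.1 h]
      · simp [not_not.1 h]
  simp only [IsStaircase, h, crossingPairs, Finset.mem_filter, Finset.mem_univ, true_and]
  exact ⟨fun H π hπ => H _ _ hπ.1 hπ.2, fun H e f h1 h2 => H (e, f) ⟨h1, h2⟩⟩

open Classical in
/-- Pairs of factorizations of `p ^ j` into `k` factors correspond to staircase matrices of powers
of `p` with total product `p ^ j`. -/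
theorem card_staircase_prime_pow {p : ℕ} (hp : p.Prime) (j : ℕ) :
    ((Fintype.piFinset fun _ : Fin k × Fin k => Finset.range (j + 1)).filter
      fun v => ∑ e, v e = j ∧ IsStaircase fun e => p ^ v e).card = divisorFun k (p ^ j) ^ 2 := by
  rw [divisorFun, sq, ← Finset.card_product]
  refine Finset.card_bij (fun v _ => (rowProd fun e => p ^ v e, colProd fun e => p ^ v e)) ?_ ?_ ?_
  · intro v hv
    obtain ⟨_, h1, _⟩ := Finset.mem_filter.1 hv
    simp only [Finset.mem_product, Nat.mem_finMulAntidiag, prod_rowProd, prod_colProd,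
      Finset.prod_pow_eq_pow_sum, h1, true_and, and_self]
    exact pow_ne_zero _ hp.ne_zero
  · intro v hv v' hv' h
    obtain ⟨_, _, h1⟩ := Finset.mem_filter.1 hv
    obtain ⟨_, _, h2⟩ := Finset.mem_filter.1 hv'
    have h3 := h1.ext h2 (fun e => pow_pos hp.pos _) (congrArg Prod.fst h) (congrArg Prod.snd h)
    funext e
    exact Nat.pow_right_injective hp.two_le (congrFun h3 e)
  · rintro ⟨n, m⟩ hnm
    obtain ⟨hn, hm⟩ := Finset.mem_product.1 hnm
    simp only at hn hm
    obtain ⟨x, hx0, hx, rfl, rfl⟩ := exists_isStaircase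
      (fun i => Nat.pos_of_ne_zero (Nat.ne_zero_of_mem_finMulAntidiag hn i))
      (fun i => Nat.pos_of_ne_zero (Nat.ne_zero_of_mem_finMulAntidiag hm i))
      ((Nat.prod_eq_of_mem_finMulAntidiag hn).trans (Nat.prod_eq_of_mem_finMulAntidiag hm).symm)
    have h1 := Nat.prod_eq_of_mem_finMulAntidiag hn
    rw [prod_rowProd] at h1
    have h2 : ∀ e, ∃ a ≤ j, x e = p ^ a := fun e =>
      (Nat.dvd_prime_pow hp).1 (h1 ▸ Finset.dvd_prod_of_mem x (Finset.mem_univ e))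
    choose v hv hxv using h2
    obtain rfl : x = fun e => p ^ v e := funext hxv
    refine ⟨v, Finset.mem_filter.2 ⟨Fintype.mem_piFinset.2 fun e =>
      Finset.mem_range.2 (Nat.lt_succ_of_le (hv e)), ?_, hx⟩, rfl⟩
    rw [Finset.prod_pow_eq_pow_sum] at h1
    exact Nat.pow_right_injective hp.two_le h1

/-- The generating function of the exponent matrices whose support contains `A`. -/
theorem hasSum_pow_support (A : Finset (Fin k × Fin k)) {q : ℝ} (hq : 0 ≤ q) (hq1 : q < 1) :
    HasSum (fun v : Fin k × Fin k → ℕ => q ^ (∑ e, v e) * if ∀ e ∈ A, v e ≠ 0 then 1 else 0)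
      (((1 - q) ^ k ^ 2)⁻¹ * q ^ A.card) := by
  have h1 : ∀ e, HasSum (fun n : ℕ => if e ∈ A then (if n = 0 then 0 else q ^ n) else q ^ n)
      ((1 - q)⁻¹ * if e ∈ A then q else 1) := fun e => by
    have hg := hasSum_geometric_of_lt_one hq hq1
    split_ifs with h
    · have h2 := hg.sub (hasSum_ite_eq 0 (1 : ℝ))
      convert h2 using 1
      · rfl
      · funext n
        rcases eq_or_ne n 0 with rfl | hn
        · simp
        · simp [hn]
      · have : 1 - q ≠ 0 := by linarith
        field_simp
        ring
    · simpa using hg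
  have h2 := hasSum_pi_prod (fun e n => by positivity) h1
  convert h2 using 1
  · funext v
    rw [← Finset.prod_pow_eq_pow_sum]
    by_cases h : ∀ e ∈ A, v e ≠ 0
    · rw [if_pos h, mul_one]
      refine Finset.prod_congr rfl fun e _ => ?_
      by_cases he : e ∈ A
      · rw [if_pos he, if_neg (h e he)]
      · rw [if_neg he]
    · rw [if_neg h, mul_zero]
      push Not at h
      obtain ⟨e, he, h⟩ := h
      exact (Finset.prod_eq_zero (Finset.mem_univ e) (by rw [if_pos he, if_pos h])).symm
  · rw [Finset.prod_mul_distrib, Finset.prod_const, Finset.prod_ite_mem, Finset.univ_inter,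
      Finset.prod_const, Finset.card_univ, Fintype.card_prod, Fintype.card_fin, inv_pow, sq]

theorem hasSum_divisorFun_sq {p : ℕ} (hp : p.Prime) :
    HasSum (fun j : ℕ => (divisorFun k (p ^ j) : ℝ) ^ 2 / (p : ℝ) ^ j)
      (((1 - 1 / (p : ℝ)) ^ k ^ 2)⁻¹ * localDensity k p) := by
  classical
  set q : ℝ := 1 / (p : ℝ) with hq
  have hp1 : (1 : ℝ) < p := by exact_mod_cast hp.one_lt
  have hq0 : 0 ≤ q := by positivity
  have hq1 : q < 1 := by rw [hq, div_lt_one (by linarith)]; exact hp1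
  have h1 : HasSum (fun v : Fin k × Fin k → ℕ =>
      q ^ (∑ e, v e) * if IsStaircase (fun e => p ^ v e) then 1 else 0)
      (((1 - q) ^ k ^ 2)⁻¹ * localDensity k p) := by
    have h2 := hasSum_sum fun (U) (_ : U ∈ (crossingPairs k).powerset) =>
      (hasSum_pow_support (cells U) hq0 hq1).mul_left ((-1) ^ U.card)
    convert h2 using 1
    · rfl
    · funext v
      simp only [isStaircase_prime_pow_iff hp]
      have h3 := sum_powerset_crossingPairs (k := k) (fun e => v e ≠ 0)
      convert congrArg (q ^ (∑ e, v e) * ·) h3.symm using 1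
      rw [Finset.mul_sum]
      exact Finset.sum_congr rfl fun U _ => by ring
    · rw [localDensity, Finset.mul_sum]
      refine Finset.sum_congr rfl fun U _ => ?_
      rw [hq, one_div, inv_pow]
      ring
  convert h1.tsum_fiberwise (fun v => ∑ e, v e) using 1
  · rfl
  funext j
  rw [tsum_subtype ((fun v : Fin k × Fin k → ℕ => ∑ e, v e) ⁻¹' {j}) (fun v =>
    q ^ (∑ e, v e) * if IsStaircase (fun e => p ^ v e) then 1 else 0),
    tsum_eq_sum (s := (Fintype.piFinset fun _ : Fin k × Fin k => Finset.range (j + 1)).filter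
      fun v => ∑ e, v e = j ∧ IsStaircase fun e => p ^ v e)]
  · rw [Finset.sum_congr rfl (g := fun _ => q ^ j), Finset.sum_const, card_staircase_prime_pow hp,
      nsmul_eq_mul, hq, one_div, inv_pow]
    · push_cast
      rfl
    · intro v hv
      obtain ⟨_, h2, h3⟩ := Finset.mem_filter.1 hv
      rw [Set.indicator_of_mem (by exact h2), if_pos h3, h2, mul_one]
  · intro v hv
    by_cases h2 : ∑ e, v e = j
    · rw [Set.indicator_of_mem (by exact h2), if_neg, mul_zero]
      refine fun h3 => hv (Finset.mem_filter.2 ⟨Fintype.mem_piFinset.2 fun e => ?_, h2, h3⟩)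
      rw [Finset.mem_range, Nat.lt_succ_iff, ← h2]
      exact Finset.single_le_sum (fun _ _ => Nat.zero_le _) (Finset.mem_univ e)
    · exact Set.indicator_of_notMem (by exact h2) _

theorem one_sub_one_div_prime_pos (p : Nat.Primes) : (0 : ℝ) < 1 - 1 / ((p : ℕ) : ℝ) := by
  have hp1 : (1 : ℝ) < (p : ℕ) := by exact_mod_cast p.2.one_lt
  rw [sub_pos, div_lt_one (by linarith)]
  exact hp1

theorem arithLocalFactor_eq_localDensity (k : ℕ) (p : Nat.Primes) :
    arithLocalFactor k p = localDensity k p := by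
  rw [arithLocalFactor, (hasSum_divisorFun_sq p.2).tsum_eq,
    mul_inv_cancel_left₀ (pow_pos (one_sub_one_div_prime_pos p) _).ne']

theorem arithLocalFactor_pos (k : ℕ) (p : Nat.Primes) : 0 < arithLocalFactor k p := by
  refine mul_pos (pow_pos (one_sub_one_div_prime_pos p) _) ?_
  refine (hasSum_divisorFun_sq p.2).summable.tsum_pos (fun j => by positivity) 0 ?_
  simp [divisorFun, Nat.finMulAntidiag_one]

/-- A nonempty set of crossing pairs involves at least two cells, so the density is `1 + O(p⁻²)`. -/
theorem abs_localDensity_sub_one_le (k : ℕ) (p : Nat.Primes) :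
    |localDensity k p - 1| ≤ 2 ^ (crossingPairs k).card * ((p : ℕ) : ℝ) ^ (-2 : ℝ) := by
  have hp : (1 : ℝ) ≤ (p : ℕ) := by exact_mod_cast p.2.one_le
  rw [localDensity, ← Finset.add_sum_erase _ _ (Finset.empty_mem_powerset _), cells_empty]
  simp only [Finset.card_empty, pow_zero, div_one, add_sub_cancel_left]
  refine (Finset.abs_sum_le_sum_abs _ _).trans ((Finset.sum_le_card_nsmul _ _
    (((p : ℕ) : ℝ) ^ (-2 : ℝ)) fun U hU => ?_).trans ?_)
  · obtain ⟨h1, h2⟩ := Finset.mem_erase.1 hU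
    have h3 := two_le_card_cells (Finset.mem_powerset.1 h2) (Finset.nonempty_iff_ne_empty.2 h1)
    rw [abs_div, abs_pow, abs_neg, abs_one, one_pow, abs_of_nonneg (by positivity),
      Real.rpow_neg (by linarith), one_div]
    refine inv_anti₀ (by positivity) ?_
    exact_mod_cast pow_le_pow_right₀ hp h3
  · rw [nsmul_eq_mul]
    refine mul_le_mul_of_nonneg_right ?_ (by positivity)
    rw [← Nat.cast_two, ← Nat.cast_pow, ← Finset.card_powerset]
    exact_mod_cast Finset.card_erase_le

theorem summable_arithLocalFactor_sub_one (k : ℕ) :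
    Summable fun p : Nat.Primes => arithLocalFactor k p - 1 := by
  refine Summable.of_norm_bounded (g := fun p : Nat.Primes =>
    (2 : ℝ) ^ (crossingPairs k).card * ((p : ℕ) : ℝ) ^ (-2 : ℝ))
    ((Nat.Primes.summable_rpow.2 (by norm_num)).mul_left _) fun p => ?_
  rw [arithLocalFactor_eq_localDensity]
  exact abs_localDensity_sub_one_le k p

theorem multipliable_arithLocalFactor (k : ℕ) : Multipliable (arithLocalFactor k) := by
  simpa using Real.multipliable_one_add_of_summable (summable_arithLocalFactor_sub_one k)

theorem arithFactor_pos (k : ℕ) : 0 < arithFactor k := by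
  have h := Real.summable_log_one_add_of_summable (summable_arithLocalFactor_sub_one k)
  simp only [add_sub_cancel] at h
  rw [arithFactor, ← Real.rexp_tsum_eq_tprod (arithLocalFactor_pos k) h]
  exact Real.exp_pos _

/-- Letting the sieving set of primes grow, the product of the local densities becomes the
arithmetic factor. -/
theorem exists_abs_staircaseSum_sub_arithFactor_le (k : ℕ) : ∃ C : ℝ, 0 ≤ C ∧
    ∀ (l : Fin k → ℝ) (N : ℕ), (∀ i, 0 ≤ l i) → (∀ i, Real.exp (l i) ≤ N) →
      |staircaseSum l N - arithFactor k * pseudomagicCount l| ≤ C * polytopeError l := by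
  obtain ⟨C, hC, h⟩ := exists_abs_staircaseSum_sub_le k
  refine ⟨C, hC, fun l N hl hN => ?_⟩
  have h1 : Tendsto (fun S : Finset Nat.Primes => ∏ p ∈ S, localDensity k p) atTop
      (𝓝 (arithFactor k)) := by
    have := (multipliable_arithLocalFactor k).hasProd
    simp only [HasProd, SummationFilter.unconditional_filter] at this
    simpa only [arithLocalFactor_eq_localDensity, arithFactor] using this
  refine le_of_tendsto ((tendsto_const_nhds.sub (h1.mul_const _)).abs) ?_
  have hfin : {p : Nat.Primes | (p : ℕ) ≤ N}.Finite :=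
    (Set.finite_Iic N).preimage (Nat.Primes.coe_nat_injective.injOn)
  filter_upwards [eventually_ge_atTop hfin.toFinset] with S hS
  exact h l N S hl hN fun p hp => hS (hfin.mem_toFinset.2 hp)

end

/-! ### Mean values of Dirichlet polynomials -/

section

theorem tendsto_average_cos (θ : ℝ) :
    Tendsto (fun T : ℝ => 1 / T * ∫ t in (0 : ℝ)..T, Real.cos (θ * t)) atTop
      (𝓝 (if θ = 0 then 1 else 0)) := by
  split_ifs with h
  · refine tendsto_const_nhds.congr' ?_
    filter_upwards [eventually_gt_atTop 0] with T hT
    simp [h, hT.ne']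
  · have h1 : ∀ T : ℝ, ∫ t in (0 : ℝ)..T, Real.cos (θ * t) = Real.sin (θ * T) / θ := fun T => by
      rw [intervalIntegral.integral_comp_mul_left _ h, integral_cos]
      simp [div_eq_inv_mul]
    simp only [h1]
    have h2 : Tendsto (fun T : ℝ => |θ|⁻¹ * T⁻¹) atTop (𝓝 0) := by
      simpa using tendsto_inv_atTop_zero.const_mul (|θ|⁻¹)
    refine squeeze_zero_norm' ?_ h2
    filter_upwards [eventually_gt_atTop 0] with T hT
    rw [Real.norm_eq_abs, abs_mul, abs_div, abs_div, abs_one, abs_of_pos hT]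
    have := Real.abs_sin_le_one (θ * T)
    have h3 : 0 < |θ| := abs_pos.2 h
    rw [one_div, mul_comm, div_eq_inv_mul]
    gcongr
    nlinarith [inv_pos.2 h3]

theorem norm_sq_sum_exp {ι : Type*} (s : Finset ι) (a θ : ι → ℝ) (t : ℝ) :
    ‖∑ n ∈ s, (a n : ℂ) * Complex.exp (((-(θ n * t) : ℝ) : ℂ) * Complex.I)‖ ^ 2 =
      ∑ n ∈ s, ∑ m ∈ s, a n * a m * Real.cos ((θ n - θ m) * t) := by
  rw [← Complex.normSq_eq_norm_sq, Complex.normSq_apply]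
  simp only [Complex.re_sum, Complex.im_sum, Complex.re_ofReal_mul, Complex.im_ofReal_mul,
    Complex.exp_ofReal_mul_I_re, Complex.exp_ofReal_mul_I_im]
  rw [Finset.sum_mul_sum, Finset.sum_mul_sum, ← Finset.sum_add_distrib]
  refine Finset.sum_congr rfl fun n _ => ?_
  rw [← Finset.sum_add_distrib]
  refine Finset.sum_congr rfl fun m _ => ?_
  rw [sub_mul, Real.cos_sub, Real.cos_neg, Real.cos_neg, Real.sin_neg, Real.sin_neg]
  ring

theorem tendsto_average_norm_sq {ι : Type*} (s : Finset ι) (a θ : ι → ℝ) :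
    Tendsto (fun T : ℝ => 1 / T * ∫ t in (0 : ℝ)..T,
      ‖∑ n ∈ s, (a n : ℂ) * Complex.exp (((-(θ n * t) : ℝ) : ℂ) * Complex.I)‖ ^ 2) atTop
      (𝓝 (∑ n ∈ s, ∑ m ∈ s, a n * a m * if θ n - θ m = 0 then 1 else 0)) := by
  have h1 : ∀ T : ℝ, 1 / T * ∫ t in (0 : ℝ)..T,
      ‖∑ n ∈ s, (a n : ℂ) * Complex.exp (((-(θ n * t) : ℝ) : ℂ) * Complex.I)‖ ^ 2 =
      ∑ n ∈ s, ∑ m ∈ s, a n * a m *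
        (1 / T * ∫ t in (0 : ℝ)..T, Real.cos ((θ n - θ m) * t)) := fun T => by
    simp only [norm_sq_sum_exp]
    rw [intervalIntegral.integral_finsetSum fun n _ =>
      (by fun_prop : Continuous _).intervalIntegrable _ _, Finset.mul_sum]
    refine Finset.sum_congr rfl fun n _ => ?_
    rw [intervalIntegral.integral_finsetSum fun n _ =>
      (by fun_prop : Continuous _).intervalIntegrable _ _, Finset.mul_sum]
    refine Finset.sum_congr rfl fun m _ => ?_
    rw [intervalIntegral.integral_const_mul]
    ring
  simp only [h1]
  exact tendsto_finsetSum _ fun n _ => tendsto_finsetSum _ fun m _ =>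
    (tendsto_average_cos _).const_mul _

variable {k : ℕ}

/-- The tuples `(n_1, …, n_k)` of positive integers with `n_i ≤ X_i`. -/
noncomputable def boundedTuples (X : Fin k → ℝ) : Finset (Fin k → ℕ) :=
  Fintype.piFinset fun i => Finset.Icc 1 ⌊X i⌋₊

/-- The diagonal contribution to the mean value of the product of the partial sums: only pairs of
tuples with equal product survive the averaging. -/
noncomputable def diagonalSum (X : Fin k → ℝ) : ℝ :=
  ∑ n ∈ boundedTuples X, ∑ m ∈ boundedTuples X,
    if ∏ i, n i = ∏ i, m i then ((∏ i, n i : ℕ) : ℝ)⁻¹ else 0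

theorem one_div_natCast_cpow {n : ℕ} (hn : n ≠ 0) (t : ℝ) :
    1 / (n : ℂ) ^ ((1 / 2 : ℂ) + (t : ℂ) * Complex.I) =
      (((n : ℝ) ^ (-(1 / 2) : ℝ) : ℝ) : ℂ) *
        Complex.exp (((-(Real.log n * t) : ℝ) : ℂ) * Complex.I) := by
  have hn' : (n : ℂ) ≠ 0 := by exact_mod_cast hn
  have hn0 : (0 : ℝ) < n := by exact_mod_cast Nat.pos_of_ne_zero hn
  rw [one_div, ← Complex.cpow_neg, Complex.cpow_def_of_ne_zero hn', Real.rpow_def_of_pos hn0,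
    Complex.ofReal_exp, ← Complex.exp_add, ← Complex.natCast_log]
  congr 1
  push_cast
  ring

theorem pos_of_mem_boundedTuples {X : Fin k → ℝ} {n : Fin k → ℕ} (hn : n ∈ boundedTuples X)
    (i : Fin k) : 0 < n i :=
  (Finset.mem_Icc.1 (Fintype.mem_piFinset.1 hn i)).1

theorem prod_zetaPartialSum (X : Fin k → ℝ) (t : ℝ) :
    ∏ i, zetaPartialSum (X i) t = ∑ n ∈ boundedTuples X,
      ((((∏ i, n i : ℕ) : ℝ) ^ (-(1 / 2) : ℝ) : ℝ) : ℂ) *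
        Complex.exp (((-(Real.log (∏ i, n i : ℕ) * t) : ℝ) : ℂ) * Complex.I) := by
  unfold zetaPartialSum
  rw [Finset.prod_univ_sum]
  refine Finset.sum_congr rfl fun n hn => ?_
  have hn0 := fun i => (pos_of_mem_boundedTuples hn i).ne'
  rw [Finset.prod_congr rfl fun i _ => one_div_natCast_cpow (hn0 i) t, Finset.prod_mul_distrib,
    ← Complex.exp_sum, ← Finset.sum_mul, ← Complex.ofReal_prod, ← Complex.ofReal_sum]
  congr 3
  · rw [Real.finsetProd_rpow _ _ fun i _ => Nat.cast_nonneg _]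
    push_cast
    rfl
  · push_cast
    rw [Real.log_prod fun i _ => by exact_mod_cast hn0 i, Finset.sum_neg_distrib, ← Finset.sum_mul]
    push_cast
    rfl

theorem tendsto_average_zetaPartialSum (X : Fin k → ℝ) :
    Tendsto (fun T : ℝ => 1 / T * ∫ t in (0 : ℝ)..T, ∏ i, ‖zetaPartialSum (X i) t‖ ^ 2)
      atTop (𝓝 (diagonalSum X)) := by
  have h := tendsto_average_norm_sq (boundedTuples X)
    (fun n => ((∏ i, n i : ℕ) : ℝ) ^ (-(1 / 2) : ℝ)) (fun n => Real.log (∏ i, n i : ℕ))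
  simp only [← prod_zetaPartialSum, norm_prod, ← Finset.prod_pow] at h
  convert h using 2
  refine Finset.sum_congr rfl fun n hn => Finset.sum_congr rfl fun m hm => ?_
  have h1 : 0 < ∏ i, n i := Finset.prod_pos fun i _ => pos_of_mem_boundedTuples hn i
  have h2 : 0 < ∏ i, m i := Finset.prod_pos fun i _ => pos_of_mem_boundedTuples hm i
  generalize ∏ i, n i = a at *
  generalize ∏ i, m i = b at *
  have h1' : (0 : ℝ) < a := by exact_mod_cast h1
  have h2' : (0 : ℝ) < b := by exact_mod_cast h2
  rcases eq_or_ne a b with rfl | hab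
  · rw [if_pos rfl, if_pos (sub_self _), mul_one, ← Real.rpow_add h1', ← Real.rpow_neg_one]
    norm_num
  · rw [if_neg hab, if_neg, mul_zero]
    exact fun h' => hab (by exact_mod_cast Real.log_injOn_pos h1' h2' (sub_eq_zero.1 h'))

theorem inPolytope_log_iff {X : Fin k → ℝ} (hX : ∀ i, 0 < X i) {x : Fin k × Fin k → ℕ}
    (hx : ∀ e, 0 < x e) :
    InPolytope (fun i => Real.log (X i)) (fun e => Real.log (x e)) ↔
      rowProd x ∈ boundedTuples X ∧ colProd x ∈ boundedTuples X := by
  have hx' : ∀ e, (x e : ℝ) ≠ 0 := fun e => by exact_mod_cast (hx e).ne'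
  have hr : ∀ i, 0 < rowProd x i := fun i => Finset.prod_pos fun j _ => hx _
  have hc : ∀ i, 0 < colProd x i := fun i => Finset.prod_pos fun j _ => hx _
  have h1 : ∀ i, ∑ j, Real.log (x (i, j)) = Real.log (rowProd x i) := fun i => by
    rw [rowProd, Nat.cast_prod, Real.log_prod fun j _ => hx' _]
  have h2 : ∀ j, ∑ i, Real.log (x (i, j)) = Real.log (colProd x j) := fun i => by
    rw [colProd, Nat.cast_prod, Real.log_prod fun j _ => hx' _]
  simp only [InPolytope, h1, h2, boundedTuples, Fintype.mem_piFinset, Finset.mem_Icc]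
  have h3 : ∀ i, Real.log (rowProd x i) ≤ Real.log (X i) ↔
      1 ≤ rowProd x i ∧ rowProd x i ≤ ⌊X i⌋₊ := fun i => by
    rw [Real.log_le_log_iff (by exact_mod_cast hr i) (hX i), Nat.le_floor_iff (hX i).le]
    exact ⟨fun h => ⟨hr i, h⟩, fun h => h.2⟩
  have h4 : ∀ i, Real.log (colProd x i) ≤ Real.log (X i) ↔
      1 ≤ colProd x i ∧ colProd x i ≤ ⌊X i⌋₊ := fun i => by
    rw [Real.log_le_log_iff (by exact_mod_cast hc i) (hX i), Nat.le_floor_iff (hX i).le]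
    exact ⟨fun h => ⟨hc i, h⟩, fun h => h.2⟩
  simp only [h3, h4]
  exact and_comm

/-- The northwest corner bijection turns pairs of tuples with equal product into staircase
matrices. -/
theorem diagonalSum_eq_staircaseSum {X : Fin k → ℝ} (hX : ∀ i, 0 < X i) {N : ℕ}
    (hN : ∀ i, X i ≤ N) : diagonalSum X = staircaseSum (fun i => Real.log (X i)) N := by
  classical
  unfold diagonalSum staircaseSum
  have h1 : ∀ x : Fin k × Fin k → Fin N,
      (if IsStaircase (fun e => (x e : ℕ) + 1) then (1 : ℝ) else 0) *
      ((∏ e, 1 / (((x e : ℕ) : ℝ) + 1)) *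
        if InPolytope (fun i => Real.log (X i)) (fun e => Real.log ((x e : ℕ) + 1)) then 1 else 0) =
      if IsStaircase (fun e => (x e : ℕ) + 1) ∧
        (rowProd (fun e => (x e : ℕ) + 1) ∈ boundedTuples X ∧
          colProd (fun e => (x e : ℕ) + 1) ∈ boundedTuples X)
      then ((∏ e, ((x e : ℕ) + 1) : ℕ) : ℝ)⁻¹ else 0 := fun x => by
    have h2 := inPolytope_log_iff hX (x := fun e => (x e : ℕ) + 1) fun e => Nat.succ_pos _
    push_cast at h2
    simp only [h2]
    simp only [one_div, Finset.prod_inv_distrib, Nat.cast_prod, Nat.cast_add, Nat.cast_one]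
    split_ifs <;> simp_all
  rw [Finset.sum_congr rfl fun x _ => h1 x, ← Finset.sum_filter, ← Finset.sum_product',
    ← Finset.sum_filter]
  symm
  refine Finset.sum_bij (fun x _ => (rowProd fun e => (x e : ℕ) + 1,
    colProd fun e => (x e : ℕ) + 1)) ?_ ?_ ?_ ?_
  · intro x hx
    obtain ⟨_, _, h2, h3⟩ := Finset.mem_filter.1 hx
    refine Finset.mem_filter.2 ⟨Finset.mem_product.2 ⟨h2, h3⟩, ?_⟩
    rw [prod_rowProd, prod_colProd]
  · intro x hx y hy h
    have h2 := (Finset.mem_filter.1 hx).2.1.ext (Finset.mem_filter.1 hy).2.1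
      (fun e => Nat.succ_pos _) (congrArg Prod.fst h) (congrArg Prod.snd h)
    funext e
    exact Fin.ext (Nat.succ_injective (congrFun h2 e))
  · rintro ⟨n, m⟩ hnm
    obtain ⟨h2, h3⟩ := Finset.mem_filter.1 hnm
    obtain ⟨hn, hm⟩ := Finset.mem_product.1 h2
    dsimp only at hn hm h3
    obtain ⟨x, hx0, hx, rfl, rfl⟩ := exists_isStaircase (pos_of_mem_boundedTuples hn)
      (pos_of_mem_boundedTuples hm) h3
    have h4 : ∀ e, x e - 1 < N := fun e => by
      have h5 : x e ≤ rowProd x e.1 := Nat.le_of_dvd (pos_of_mem_boundedTuples hn _)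
        (Finset.dvd_prod_of_mem (fun j => x (e.1, j)) (Finset.mem_univ e.2))
      have h6 := (Finset.mem_Icc.1 (Fintype.mem_piFinset.1 hn e.1)).2
      have h7 : ⌊X e.1⌋₊ ≤ N := Nat.floor_le_of_le (hN _)
      have := hx0 e
      omega
    have h5 : (fun e => x e - 1 + 1) = x := funext fun e => Nat.sub_add_cancel (hx0 e)
    refine ⟨fun e => ⟨x e - 1, h4 e⟩, Finset.mem_filter.2 ⟨Finset.mem_univ _, ?_⟩, ?_⟩
    · simp only [h5]
      exact ⟨hx, hn, hm⟩
    · simp only [h5]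
  · intro x _
    rw [prod_rowProd]

end

/-! ### The asymptotic formula -/

section

variable {k : ℕ}

/-- The approximation of the diagonal sum, with a constant that depends on `k` only. -/
theorem exists_abs_diagonalSum_sub_le (k : ℕ) : ∃ C : ℝ, ∀ X : Fin k → ℝ, (∀ i, 1 ≤ X i) →
    |diagonalSum X - arithFactor k * pseudomagicCount fun i => Real.log (X i)| ≤
      C * polytopeError fun i => Real.log (X i) := by
  obtain ⟨C, _, h⟩ := exists_abs_staircaseSum_sub_arithFactor_le k
  refine ⟨C, fun X hX => ?_⟩
  have hX0 : ∀ i, 0 < X i := fun i => zero_lt_one.trans_le (hX i)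
  obtain ⟨N, hN⟩ : ∃ N : ℕ, ∀ i, X i ≤ N :=
    ⟨∑ i, ⌈X i⌉₊, fun i => (Nat.le_ceil _).trans (by
      exact_mod_cast Finset.single_le_sum (f := fun i => ⌈X i⌉₊) (fun _ _ => Nat.zero_le _)
        (Finset.mem_univ i))⟩
  rw [diagonalSum_eq_staircaseSum hX0 hN]
  exact h _ N (fun i => Real.log_nonneg (hX i)) fun i => by rw [Real.exp_log (hX0 i)]; exact hN i

/-- The polytope contains the box whose sides are its side lengths divided by `k`. -/
theorem prod_le_pseudomagicCount (hk : 1 ≤ k) {l : Fin k → ℝ} (hl : ∀ i, 0 ≤ l i) :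
    ∏ e : Fin k × Fin k, (⌊min (l e.1) (l e.2) / k⌋₊ + 1) ≤ pseudomagicCount l := by
  have hk' : (0 : ℝ) < k := by exact_mod_cast hk
  set s : Finset (Fin k × Fin k → ℕ) := Fintype.piFinset fun e =>
    Finset.range (⌊min (l e.1) (l e.2) / k⌋₊ + 1) with hs
  have h1 : ∏ e : Fin k × Fin k, (⌊min (l e.1) (l e.2) / k⌋₊ + 1) = s.card := by
    simp [hs, Fintype.card_piFinset]
  have hinj : Function.Injective
      fun (x : Fin k × Fin k → ℕ) => (fun i j => x (i, j) : Matrix (Fin k) (Fin k) ℕ) := by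
    intro x y h
    funext ⟨i, j⟩
    exact congrFun (congrFun h i) j
  rw [h1, ← Set.ncard_coe_finset, ← Set.ncard_image_of_injective _ hinj, pseudomagicCount]
  refine Set.ncard_le_ncard ?_ (pseudomagicSquares_finite l)
  rintro _ ⟨x, hx, rfl⟩
  have hx' : ∀ e, (x e : ℝ) ≤ min (l e.1) (l e.2) / k := fun e => by
    have h2 := Finset.mem_range.1 (Fintype.mem_piFinset.1 (Finset.mem_coe.1 hx) e)
    exact (Nat.le_floor_iff (div_nonneg (le_min (hl _) (hl _)) hk'.le)).1 (Nat.lt_succ_iff.1 h2)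
  refine ⟨fun j => ?_, fun i => ?_⟩
  · calc ∑ i, (x (i, j) : ℝ) ≤ ∑ _i : Fin k, l j / k := Finset.sum_le_sum fun i _ =>
          (hx' (i, j)).trans (div_le_div_of_nonneg_right (min_le_right _ _) hk'.le)
      _ = l j := by simp; field_simp
  · calc ∑ j, (x (i, j) : ℝ) ≤ ∑ _j : Fin k, l i / k := Finset.sum_le_sum fun j _ =>
          (hx' (i, j)).trans (div_le_div_of_nonneg_right (min_le_left _ _) hk'.le)
      _ = l i := by simp; field_simp

/-- The error term is smaller than the number of lattice points by a factor of the order of the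
smallest side length. -/
theorem polytopeError_le (hk : 1 ≤ k) {l : Fin k → ℝ} (hl : ∀ i, 0 ≤ l i) :
    polytopeError l ≤ ((k : ℝ) + 1) ^ Fintype.card (Fin k × Fin k) *
      (pseudomagicCount l * ∑ e : Fin k × Fin k, (1 + min (l e.1) (l e.2))⁻¹) := by
  have hk' : (0 : ℝ) < k := by exact_mod_cast hk
  have hpos : ∀ e : Fin k × Fin k, 0 < 1 + min (l e.1) (l e.2) := fun e =>
    add_pos_of_pos_of_nonneg one_pos (le_min (hl _) (hl _))
  have h1 : ∏ e : Fin k × Fin k, (1 + min (l e.1) (l e.2)) ≤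
      ((k : ℝ) + 1) ^ Fintype.card (Fin k × Fin k) * pseudomagicCount l := by
    calc _ ≤ ∏ e : Fin k × Fin k, (((k : ℝ) + 1) * ((⌊min (l e.1) (l e.2) / k⌋₊ + 1 : ℕ) : ℝ)) := by
          refine Finset.prod_le_prod (fun e _ => (hpos e).le) fun e _ => ?_
          have h2 := (div_lt_iff₀ hk').1 (Nat.lt_floor_add_one (min (l e.1) (l e.2) / k))
          have h3 : (0 : ℝ) ≤ ⌊min (l e.1) (l e.2) / k⌋₊ := Nat.cast_nonneg _
          push_cast
          nlinarith
      _ = ((k : ℝ) + 1) ^ Fintype.card (Fin k × Fin k) *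
          ((∏ e : Fin k × Fin k, (⌊min (l e.1) (l e.2) / k⌋₊ + 1) : ℕ) : ℝ) := by
          rw [Finset.prod_mul_distrib, Finset.prod_const, Finset.card_univ, Nat.cast_prod]
      _ ≤ _ := by
          gcongr
          exact prod_le_pseudomagicCount hk hl
  rw [← mul_assoc, Finset.mul_sum]
  refine Finset.sum_le_sum fun e _ => ?_
  rw [← div_eq_mul_inv, le_div_iff₀ (hpos e),
    Finset.prod_erase_mul _ (fun f : Fin k × Fin k => 1 + min (l f.1) (l f.2)) (Finset.mem_univ e)]
  exact h1

theorem diagonalSum_sub_isBigO {X : Fin k → ℝ → ℝ} (hX : ∀ i, Tendsto (X i) atTop atTop) :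
    (fun Y : ℝ => (diagonalSum fun i => X i Y) -
        arithFactor k * pseudomagicCount fun i => Real.log (X i Y)) =O[atTop]
      fun Y => polytopeError fun i => Real.log (X i Y) := by
  obtain ⟨C, hC⟩ := exists_abs_diagonalSum_sub_le k
  refine IsBigO.of_bound C ?_
  filter_upwards [eventually_all.2 fun i => (hX i).eventually_ge_atTop 1] with Y hY
  rw [Real.norm_eq_abs, Real.norm_eq_abs,
    abs_of_nonneg (polytopeError_nonneg fun i => Real.log_nonneg (hY i))]
  exact hC _ hY

theorem polytopeError_isLittleO (hk : 1 ≤ k) {l : Fin k → ℝ → ℝ}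
    (hl : ∀ i, Tendsto (l i) atTop atTop) :
    (fun Y : ℝ => polytopeError fun i => l i Y) =o[atTop]
      fun Y => (pseudomagicCount fun i => l i Y : ℝ) := by
  have h1 : (fun Y : ℝ => polytopeError fun i => l i Y) =O[atTop]
      fun Y => (pseudomagicCount fun i => l i Y : ℝ) *
        ∑ e : Fin k × Fin k, (1 + min (l e.1 Y) (l e.2 Y))⁻¹ := by
    refine IsBigO.of_bound (((k : ℝ) + 1) ^ Fintype.card (Fin k × Fin k)) ?_
    filter_upwards [eventually_all.2 fun i => (hl i).eventually_ge_atTop 0] with Y hY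
    rw [Real.norm_eq_abs, Real.norm_eq_abs, abs_of_nonneg (polytopeError_nonneg hY)]
    refine (polytopeError_le hk hY).trans ?_
    gcongr
    exact le_abs_self _
  have h2 : Tendsto (fun Y : ℝ => ∑ e : Fin k × Fin k, (1 + min (l e.1 Y) (l e.2 Y))⁻¹) atTop
      (𝓝 0) := by
    rw [← Finset.sum_const_zero (s := (Finset.univ : Finset (Fin k × Fin k)))]
    refine tendsto_finsetSum _ fun e _ => ?_
    have h3 : Tendsto (fun Y => min (l e.1 Y) (l e.2 Y)) atTop atTop :=
      tendsto_atTop.2 fun b => by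
        filter_upwards [(hl e.1).eventually_ge_atTop b, (hl e.2).eventually_ge_atTop b]
          with Y h4 h5 using le_min h4 h5
    exact (tendsto_atTop_add_const_left _ 1 h3).inv_tendsto_atTop
  refine h1.trans_isLittleO ?_
  simpa using (isBigO_refl (fun Y => (pseudomagicCount fun i => l i Y : ℝ)) atTop).mul_isLittleO
    ((isLittleO_one_iff ℝ).2 h2)

theorem polytopeError_isBigO {l : Fin k → ℝ → ℝ} (hl : ∀ i, Tendsto (l i) atTop atTop)
    (hlog : ∀ i, l i =O[atTop] Real.log) :
    (fun Y : ℝ => polytopeError fun i => l i Y) =O[atTop] fun Y => Real.log Y ^ (k ^ 2 - 1) := by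
  have h1 : ∀ f : Fin k × Fin k, (fun Y => 1 + min (l f.1 Y) (l f.2 Y)) =O[atTop] Real.log :=
    fun f => by
    refine IsBigO.add Real.isLittleO_const_log_atTop.isBigO (IsBigO.trans ?_ (hlog f.1))
    refine IsBigO.of_bound 1 ?_
    filter_upwards [(hl f.1).eventually_ge_atTop 0, (hl f.2).eventually_ge_atTop 0] with Y h2 h3
    rw [Real.norm_eq_abs, Real.norm_eq_abs, abs_of_nonneg (le_min h2 h3), abs_of_nonneg h2, one_mul]
    exact min_le_left _ _
  unfold polytopeError
  refine IsBigO.fun_sum fun e _ => ?_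
  have h2 := IsBigO.finsetProd (s := Finset.univ.erase e) (fun f (_ : f ∈ _) => h1 f)
  have h3 : (Finset.univ.erase e).card = k ^ 2 - 1 := by
    rw [Finset.card_erase_of_mem (Finset.mem_univ e), Finset.card_univ, Fintype.card_prod,
      Fintype.card_fin, sq]
  simpa only [Finset.prod_const, h3] using h2

theorem isBigO_log_rpow {m : ℝ → ℝ} (hm : m =O[atTop] fun _ => (1 : ℝ)) :
    (fun Y : ℝ => Real.log (Y ^ m Y)) =O[atTop] Real.log := by
  have h1 : (fun Y => m Y * Real.log Y) =O[atTop] Real.log := by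
    simpa using hm.mul (isBigO_refl Real.log atTop)
  refine h1.congr' ?_ EventuallyEq.rfl
  filter_upwards [eventually_gt_atTop 0] with Y hY
  rw [Real.log_rpow hY]

theorem diagonalSum_asymptotics (hk : 1 ≤ k) {m : Fin k → ℝ → ℝ}
    (hm : ∀ i, m i =O[atTop] fun _ => (1 : ℝ))
    (hX : ∀ i, Tendsto (fun Y : ℝ => Y ^ m i Y) atTop atTop) :
    ((fun Y : ℝ => diagonalSum fun i => Y ^ m i Y) ~[atTop]
      fun Y => arithFactor k * pseudomagicCount fun i => Real.log (Y ^ m i Y)) ∧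
    ((fun Y : ℝ => (diagonalSum fun i => Y ^ m i Y) -
        arithFactor k * pseudomagicCount fun i => Real.log (Y ^ m i Y))
      =O[atTop] fun Y => Real.log Y ^ (k ^ 2 - 1)) := by
  have h1 := diagonalSum_sub_isBigO hX
  have hl : ∀ i, Tendsto (fun Y : ℝ => Real.log (Y ^ m i Y)) atTop atTop := fun i =>
    Real.tendsto_log_atTop.comp (hX i)
  refine ⟨?_, h1.trans (polytopeError_isBigO hl fun i => isBigO_log_rpow (hm i))⟩
  refine (h1.trans_isLittleO (polytopeError_isLittleO hk hl)).trans_isBigO ?_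
  exact isBigO_self_const_mul (arithFactor_pos k).ne' _ _

end

theorem mainTheorem3 (k : ℕ) (hk : 1 ≤ k) :
    -- the series and the product that define `a_k` converge
    (∀ p : Nat.Primes, Summable fun j : ℕ =>
      (divisorFun k ((p : ℕ) ^ j) : ℝ) ^ 2 / ((p : ℕ) : ℝ) ^ j) ∧
    Multipliable (arithLocalFactor k) ∧
    0 < arithFactor k ∧
    ∃ L : (Fin k → ℝ) → ℝ,
      -- `L X` is the limit of the averages for the lengths `X_1, …, X_k`
      (∀ X : Fin k → ℝ,
        Tendsto (fun T : ℝ => 1 / T * ∫ t in (0 : ℝ)..T, ∏ i, ‖zetaPartialSum (X i) t‖ ^ 2)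
          atTop (𝓝 (L X))) ∧
      -- the asymptotic formula, and its form with an error term
      (∀ m : Fin k → ℝ → ℝ,
        (∀ i, m i =O[atTop] (fun _ => (1 : ℝ))) →
        (∀ i, Tendsto (fun Y : ℝ => Y ^ m i Y) atTop atTop) →
        ((fun Y : ℝ => L fun i => Y ^ m i Y) ~[atTop]
          fun Y => arithFactor k * pseudomagicCount fun i => Real.log (Y ^ m i Y)) ∧
        ((fun Y : ℝ => (L fun i => Y ^ m i Y) -
            arithFactor k * pseudomagicCount fun i => Real.log (Y ^ m i Y))
          =O[atTop] fun Y => Real.log Y ^ (k ^ 2 - 1))) ∧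
      -- the case of equal lengths
      (∀ X : ℝ,
        Tendsto (fun T : ℝ => 1 / T * ∫ t in (0 : ℝ)..T, ‖zetaPartialSum X t‖ ^ (2 * k))
          atTop (𝓝 (L fun _ => X))) ∧
      ((fun X : ℝ => (L fun _ => X) -
          arithFactor k * pseudomagicCount fun _ : Fin k => Real.log X)
        =O[atTop] fun X => Real.log X ^ (k ^ 2 - 1)) := by
  refine ⟨fun p => (hasSum_divisorFun_sq p.2).summable, multipliable_arithLocalFactor k,
    arithFactor_pos k, diagonalSum, tendsto_average_zetaPartialSum,
    fun m hm hX => diagonalSum_asymptotics hk hm hX, fun X => ?_, ?_⟩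
  · have h := tendsto_average_zetaPartialSum fun _ : Fin k => X
    simpa only [Finset.prod_const, Finset.card_univ, Fintype.card_fin, ← pow_mul] using h
  · have h := (diagonalSum_asymptotics hk (m := fun _ _ => 1) (fun _ => isBigO_refl _ _)
      fun _ => by simp only [Real.rpow_one]; exact tendsto_id).2
    simpa only [Real.rpow_one] using h
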